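/- Let $S^1=\mathbb{R}/\mathbb{Z}$. An \emph{arc} is a chord of the closed unit disk, given by its unordered pair of endpoints on the boundary circle $S^1$. The \emph{primary arc} of an interval $[a,b]$ of the circle is the arc joining $a+\tfrac14(b-a)$ and $a+\tfrac34(b-a)$. An \emph{arc diagram} is a finite collection of arcs obtained from the two arcs $\{1/3,2/3\}$ and $\{1/6,5/6\}$ by finitely many (possibly zero) steps, each of which adds the primary arc of one of the intervals into which the endpoints of the current arcs divide the circle. An arc diagram is regarded as a $2$-complex, whose edges are its arcs and the intervals into which it divides the circle and whose faces are the regions into which the arcs divide the disk. Given an orientation-preserving isomorphism between two arc diagrams $\mathcal D$ and $\mathcal R$, the homeomorphism $f\colon S^1\to S^1$ that sends each interval of $\mathcal D$ linearly onto the corresponding interval of $\mathcal R$ is called a \emph{dyadic rearrangement of the Basilica}. Let $T_B$ be the set of all dyadic rearrangements of the Basilica. Let $\alpha,\beta,\gamma$ be the orientation-preserving piecewise-linear homeomorphisms of $S^1$ that send the following domain breakpoints, in order, to the following range breakpoints and are linear on each of the intervals between consecutive domain breakpoints (taken cyclically): $$ \begin{array}{c|c|c} & \text{domain breakpoints} &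 \text{range breakpoints}\\ \hline \alpha & 1/3,\ 2/3 & 1/6,\ 5/6\\ \beta & 1/6,\ 2/3,\ 17/24,\ 5/6 & 1/6,\ 7/24,\ 1/3,\ 5/6\\ \gamma & 1/6,\ 7/24,\ 29/96,\ 1/3 & 1/6,\ 19/96,\ 5/24,\ 1/3 \end{array} $$ and let $\delta(\theta)=\theta+1/2$. Theorem. $T_B$ is a group under composition, and it is generated by the four elements $\alpha,\beta,\gamma,\delta$. In particular, $T_B$ is finitely generated. -/

import Mathlib

namespace Basilica

/-- An arc in the closed unit disk, recorded by its unordered pair of endpoints on the circle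
`ℝ / ℤ`. -/
abbrev Arc := Sym2 UnitAddCircle

/-- The points of the circle that are endpoints of some arc of `D`. -/
def vertices (D : Set Arc) : Set UnitAddCircle := {p | ∃ A ∈ D, p ∈ A}

/-- `[a, b]` is (a lift to the line of) one of the intervals into which the arcs of `D` divide
the circle: `a < b` are lifts of endpoints of arcs, with no endpoint strictly in between. -/
def IsInterval (D : Set Arc) (a b : ℝ) : Prop :=
  a < b ∧ (a : UnitAddCircle) ∈ vertices D ∧ (b : UnitAddCircle) ∈ vertices D ∧
    ∀ x ∈ Set.Ioo a b, (x : UnitAddCircle) ∉ vertices D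

/-- The primary arc of the interval `[a, b]`: its endpoints subdivide `[a, b]` with ratios
`1 : 2 : 1`. -/
noncomputable def primaryArc (a b : ℝ) : Arc :=
  s(((a + (b - a) / 4 : ℝ) : UnitAddCircle), ((a + 3 * (b - a) / 4 : ℝ) : UnitAddCircle))

/-- The arc diagram consisting of the two arcs `{1/3, 2/3}` and `{1/6, 5/6}`. -/
noncomputable def baseDiagram : Set Arc :=
  {s(((1 / 3 : ℝ) : UnitAddCircle), ((2 / 3 : ℝ) : UnitAddCircle)),
   s(((1 / 6 : ℝ) : UnitAddCircle), ((5 / 6 : ℝ) : UnitAddCircle))}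

/-- Arc diagrams: the finite collections of arcs obtained from `{1/3, 2/3}` and `{1/6, 5/6}` by
repeatedly adding the primary arc of one of the current intervals. -/
inductive IsArcDiagram : Set Arc → Prop
  | base : IsArcDiagram baseDiagram
  | expand {D : Set Arc} {a b : ℝ} (hD : IsArcDiagram D) (hab : IsInterval D a b) :
      IsArcDiagram (insert (primaryArc a b) D)

/-- `q` is the vertex of `D` that follows `p` counterclockwise, i.e. `D` has an interval that
runs counterclockwise from `p` to `q`. -/
def IsNext (D : Set Arc) (p q : vertices D) : Prop :=
  ∃ a b : ℝ, IsInterval D a b ∧ (a : UnitAddCircle) = p ∧ (b : UnitAddCircle) = q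

/-- An orientation-preserving isomorphism between the planar 2-complexes of two arc diagrams.
The vertices are the endpoints of arcs, the edges are the arcs and the intervals of the boundary
circle, and the faces are the regions into which the arcs cut the disk.  Edges are determined by
their kind and their endpoints, and the faces by the arcs and the circular order of the vertices,
so an isomorphism is a bijection of vertices that respects arcs and counterclockwise intervals. -/
structure DiagramIso (D R : Set Arc) where
  toEquiv : vertices D ≃ vertices R
  arc_iff : ∀ p q : vertices D,
    s((p : UnitAddCircle), (q : UnitAddCircle)) ∈ D ↔
      s((toEquiv p : UnitAddCircle), (toEquiv q : UnitAddCircle)) ∈ R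
  next_iff : ∀ p q : vertices D, IsNext D p q ↔ IsNext R (toEquiv p) (toEquiv q)

/-- The homeomorphism `f` of the circle sends each interval `[a, b]` of `D` linearly onto the
interval `[c, d]` of `R` that corresponds to it under the isomorphism `φ`. -/
def DiagramIso.Induces {D R : Set Arc} (φ : DiagramIso D R)
    (f : UnitAddCircle ≃ₜ UnitAddCircle) : Prop :=
  ∀ (p q : vertices D) (a b c d : ℝ), IsInterval D a b → IsInterval R c d →
    (a : UnitAddCircle) = p → (b : UnitAddCircle) = q →
    (c : UnitAddCircle) = φ.toEquiv p → (d : UnitAddCircle) = φ.toEquiv q →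
    ∀ t ∈ Set.Icc (0 : ℝ) 1,
      f ((a + t * (b - a) : ℝ) : UnitAddCircle) = ((c + t * (d - c) : ℝ) : UnitAddCircle)

/-- The set `T_B` of dyadic rearrangements of the Basilica: the homeomorphisms of the circle
defined by an isomorphism between two arc diagrams. -/
def dyadicRearrangements : Set (UnitAddCircle ≃ₜ UnitAddCircle) :=
  {f | ∃ D R : Set Arc, IsArcDiagram D ∧ IsArcDiagram R ∧ ∃ φ : DiagramIso D R, φ.Induces f}

section Lifts

variable {a : ℝ} {F : ℝ → ℝ}

theorem liftIco_bijective (hc : Continuous F) (hm : StrictMonoOn F (Set.Icc a (a + 1)))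
    (hp : F (a + 1) = F a + 1) :
    Function.Bijective (AddCircle.liftIco 1 a fun x => (F x : UnitAddCircle)) := by
  have hF : ∀ x ∈ Set.Ico a (a + 1), F x ∈ Set.Ico (F a) (F a + 1) := fun x hx =>
    ⟨hm.monotoneOn (by simp) ⟨hx.1, hx.2.le⟩ hx.1,
      hp ▸ hm ⟨hx.1, hx.2.le⟩ (by simp) hx.2⟩
  have rep : ∀ (b : ℝ) (z : UnitAddCircle), ∃ x ∈ Set.Ico b (b + 1), (x : UnitAddCircle) = z :=
    fun b z => by
      have h : z ∈ ((↑) : ℝ → UnitAddCircle) '' Set.Ico b (b + 1) := by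
        rw [AddCircle.coe_image_Ico_eq]; trivial
      exact h
  constructor
  · intro z w h
    obtain ⟨x, hx, rfl⟩ := rep a z
    obtain ⟨y, hy, rfl⟩ := rep a w
    rw [AddCircle.liftIco_coe_apply hx, AddCircle.liftIco_coe_apply hy,
      AddCircle.coe_eq_coe_iff_of_mem_Ico (hF x hx) (hF y hy)] at h
    rw [hm.injOn ⟨hx.1, hx.2.le⟩ ⟨hy.1, hy.2.le⟩ h]
  · intro z
    obtain ⟨y, hy, rfl⟩ := rep (F a) z
    obtain ⟨x, hx, rfl⟩ := intermediate_value_Ico (by simp : a ≤ a + 1) hc.continuousOn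
      (by rw [hp]; exact hy)
    exact ⟨x, AddCircle.liftIco_coe_apply hx⟩

end Lifts

/-- The homeomorphism of the circle that sends the class of `x` to the class of `F x` for
`x ∈ [a, a + 1]`, where `F` is increasing on `[a, a + 1]` and `F (a + 1) = F a + 1`. -/
noncomputable def circleHomeo (a : ℝ) (F : ℝ → ℝ) (hc : Continuous F)
    (hm : StrictMonoOn F (Set.Icc a (a + 1))) (hp : F (a + 1) = F a + 1) :
    UnitAddCircle ≃ₜ UnitAddCircle :=
  Continuous.homeoOfEquivCompactToT2 (f := Equiv.ofBijective _ (liftIco_bijective hc hm hp))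
    (AddCircle.liftIco_continuous (by simp [hp])
      ((AddCircle.continuous_mk' 1).comp hc).continuousOn)

theorem circleHomeo_apply {a : ℝ} {F : ℝ → ℝ} {hc : Continuous F}
    {hm : StrictMonoOn F (Set.Icc a (a + 1))} {hp : F (a + 1) = F a + 1} {x : ℝ}
    (hx : x ∈ Set.Ico a (a + 1)) :
    circleHomeo a F hc hm hp (x : UnitAddCircle) = (F x : UnitAddCircle) :=
  AddCircle.liftIco_coe_apply (f := fun x => (F x : UnitAddCircle)) hx

/-- On `[1/3, 4/3]`: breakpoints `1/3 ↦ 1/6` and `2/3 ↦ 5/6`. -/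
noncomputable def alphaLift (x : ℝ) : ℝ := if x ≤ 2 / 3 then 2 * x - 1 / 2 else x / 2 + 1 / 2

/-- On `[1/6, 7/6]`: breakpoints `1/6 ↦ 1/6`, `2/3 ↦ 7/24`, `17/24 ↦ 1/3` and `5/6 ↦ 5/6`. -/
noncomputable def betaLift (x : ℝ) : ℝ :=
  if x ≤ 2 / 3 then x / 4 + 1 / 8
  else if x ≤ 17 / 24 then x - 3 / 8
  else if x ≤ 5 / 6 then 4 * x - 5 / 2
  else x

/-- On `[1/6, 7/6]`: breakpoints `1/6 ↦ 1/6`, `7/24 ↦ 19/96`, `29/96 ↦ 5/24` and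
`1/3 ↦ 1/3`. -/
noncomputable def gammaLift (x : ℝ) : ℝ :=
  if x ≤ 7 / 24 then x / 4 + 1 / 8
  else if x ≤ 29 / 96 then x - 3 / 32
  else if x ≤ 1 / 3 then 4 * x - 1
  else x

/-- The generator `α`. -/
noncomputable def alpha : UnitAddCircle ≃ₜ UnitAddCircle :=
  circleHomeo (1 / 3) alphaLift
    (Continuous.if_le (by fun_prop) (by fun_prop) continuous_id continuous_const
      fun x hx => by rw [hx]; norm_num)
    (fun x _ y _ h => by simp only [alphaLift]; split_ifs <;> linarith)
    (by norm_num [alphaLift])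

/-- The generator `β`. -/
noncomputable def beta : UnitAddCircle ≃ₜ UnitAddCircle :=
  circleHomeo (1 / 6) betaLift
    (Continuous.if_le (by fun_prop)
      (Continuous.if_le (by fun_prop)
        (Continuous.if_le (by fun_prop) (by fun_prop) continuous_id continuous_const
          fun x hx => by rw [hx]; norm_num)
        continuous_id continuous_const
        fun x hx => by rw [hx]; norm_num)
      continuous_id continuous_const
      fun x hx => by rw [hx]; norm_num)
    (fun x _ y _ h => by simp only [betaLift]; split_ifs <;> linarith)
    (by norm_num [betaLift])

/-- The generator `γ`. -/
noncomputable def gamma : UnitAddCircle ≃ₜ UnitAddCircle :=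
  circleHomeo (1 / 6) gammaLift
    (Continuous.if_le (by fun_prop)
      (Continuous.if_le (by fun_prop)
        (Continuous.if_le (by fun_prop) (by fun_prop) continuous_id continuous_const
          fun x hx => by rw [hx]; norm_num)
        continuous_id continuous_const
        fun x hx => by rw [hx]; norm_num)
      continuous_id continuous_const
      fun x hx => by rw [hx]; norm_num)
    (fun x _ y _ h => by simp only [gammaLift]; split_ifs <;> linarith)
    (by norm_num [gammaLift])

/-- The generator `δ`, the half turn `θ ↦ θ + 1/2`. -/
noncomputable def delta : UnitAddCircle ≃ₜ UnitAddCircle :=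
  Homeomorph.addRight ((1 / 2 : ℝ) : UnitAddCircle)

end Basilica

open Set

namespace Basilica

/-! Every diagram consists of the arc {1/6, 5/6} and a ternary tree of subdivisions on each of its
two sides (`IsArcDiagram.exists_tree`). A homeomorphism is a dyadic rearrangement exactly when it
carries the arcs of one diagram onto those of another and each interval linearly onto an interval
(`mem_dyadicRearrangements_iff`). Linear maps preserve the ratios 1 : 2 : 1, so an expansion of the
domain diagram is carried to an expansion of the range diagram. Any two diagrams have a common
expansion, a deep complete one, and therefore rearrangements compose.

For generation, let H be the subgroup generated by α, β, γ, δ. Under H, every interval obtained by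
subdividing the two sides is equivalent to [1/6, 5/6] or to [1/6, 1/3] (`IsStandard`). Hence H is
transitive on oriented arcs (`exists_move_to_root`), and a rearrangement can be corrected by an
element of H so that it fixes 1/6 and 5/6. On each side it then matches the leaves of two trees in
order and respects the pairing of arc endpoints, so the two trees spell the same word of parentheses
(`Carries.word_eq`).

Trees with the same word differ by rebracketing (`assoc_of_word_eq`). At the root of [1/6, 5/6] or
[1/6, 1/3] one rebracketing is performed by β or γ; a conjugate by an element of H performs it on
any standard interval and is the identity elsewhere (`Assoc.exists_carriesLeaves`). Elements of H
supported on the two sides thus undo the corrected rearrangement leaf by leaf, which places it in H.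
-/

theorem coe_add_int (x : ℝ) (n : ℤ) : ((x + n : ℝ) : UnitAddCircle) = x := by
  have : ((n : ℝ) : UnitAddCircle) = 0 := (AddCircle.coe_eq_zero_iff 1).2 ⟨n, by simp⟩
  rw [AddCircle.coe_add, this, add_zero]

theorem coe_sub_int (x : ℝ) (n : ℤ) : ((x - n : ℝ) : UnitAddCircle) = x := by
  simp

theorem coe_eq_coe_iff {x y : ℝ} : (x : UnitAddCircle) = y ↔ ∃ n : ℤ, x = y + n := by
  constructor
  · intro h
    have h0 : ((x - y : ℝ) : UnitAddCircle) = 0 := by rw [AddCircle.coe_sub, h, sub_self]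
    obtain ⟨n, hn⟩ := (AddCircle.coe_eq_zero_iff 1).1 h0
    exact ⟨n, by simp at hn; linarith⟩
  · rintro ⟨n, rfl⟩
    exact coe_add_int y n

theorem eq_of_coe_eq {x y : ℝ} (h : (x : UnitAddCircle) = y) (h1 : x < y + 1) (h2 : y < x + 1) :
    x = y := by
  obtain ⟨n, hn⟩ := coe_eq_coe_iff.1 h
  have h3 : (n : ℝ) < 1 := by linarith
  have h4 : (-1 : ℝ) < n := by linarith
  have h5 : n = 0 := by
    have : n < 1 := by exact_mod_cast h3
    have : -1 < n := by exact_mod_cast h4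
    omega
  simpa [h5] using hn

/-! ### Intervals of a set of arcs -/

section Intervals

variable {D : Set Arc} {a b x y : ℝ}

theorem IsInterval.translate (h : IsInterval D a b) (n : ℤ) : IsInterval D (a + n) (b + n) := by
  obtain ⟨h1, h2, h3, h4⟩ := h
  refine ⟨by linarith, by rwa [coe_add_int], by rwa [coe_add_int], fun z hz => ?_⟩
  rw [← coe_sub_int z n]
  exact h4 _ ⟨by linarith [hz.1], by linarith [hz.2]⟩

theorem IsInterval.right_unique (h : IsInterval D a x) (h' : IsInterval D a y) : x = y := by
  rcases lt_trichotomy x y with hlt | heq | hlt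
  · exact absurd h.2.2.1 (h'.2.2.2 x ⟨h.1, hlt⟩)
  · exact heq
  · exact absurd h'.2.2.1 (h.2.2.2 y ⟨h'.1, hlt⟩)

theorem IsInterval.left_unique (h : IsInterval D x b) (h' : IsInterval D y b) : x = y := by
  rcases lt_trichotomy x y with hlt | heq | hlt
  · exact absurd h'.2.1 (h.2.2.2 y ⟨hlt, h'.1⟩)
  · exact heq
  · exact absurd h.2.1 (h'.2.2.2 x ⟨hlt, h.1⟩)

theorem IsInterval.le_add_one (h : IsInterval D a b) : b ≤ a + 1 := by
  by_contra! hlt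
  refine h.2.2.2 (a + 1) ⟨by linarith, hlt⟩ ?_
  have := coe_add_int a 1
  rw [Int.cast_one] at this
  rw [this]
  exact h.2.1

theorem IsInterval.eq_of_overlap (h : IsInterval D a b) (h' : IsInterval D x y) {z : ℝ}
    (hz : z ∈ Ioo a b) (hz' : z ∈ Ioo x y) : x = a := by
  rcases lt_trichotomy x a with hlt | heq | hlt
  · exact absurd h.2.1 (h'.2.2.2 a ⟨hlt, hz.1.trans hz'.2⟩)
  · exact heq
  · exact absurd h'.2.1 (h.2.2.2 x ⟨hlt, hz'.1.trans hz.2⟩)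

theorem mem_vertices_insert {D : Set Arc} {p u v : UnitAddCircle} :
    p ∈ vertices (insert s(u, v) D) ↔ p = u ∨ p = v ∨ p ∈ vertices D := by
  simp [vertices, or_assoc]

theorem mem_vertices_insert_primaryArc {D : Set Arc} {p : UnitAddCircle} {a b : ℝ} :
    p ∈ vertices (insert (primaryArc a b) D) ↔
      p = ((a + (b - a) / 4 : ℝ) : UnitAddCircle) ∨
        p = ((a + 3 * (b - a) / 4 : ℝ) : UnitAddCircle) ∨ p ∈ vertices D :=
  mem_vertices_insert

theorem IsInterval.notMem_quarter (h : IsInterval D a b) :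
    ((a + (b - a) / 4 : ℝ) : UnitAddCircle) ∉ vertices D :=
  h.2.2.2 _ ⟨by linarith [h.1], by linarith [h.1]⟩

theorem IsInterval.notMem_three_quarter (h : IsInterval D a b) :
    ((a + 3 * (b - a) / 4 : ℝ) : UnitAddCircle) ∉ vertices D :=
  h.2.2.2 _ ⟨by linarith [h.1], by linarith [h.1]⟩

/-- The new vertices have lifts only inside translates of `[a, b]`, and two intervals that overlap
have the same left endpoint. -/
theorem IsInterval.insert_of_ne (h : IsInterval D a b) (h' : IsInterval D x y)
    (hne : (x : UnitAddCircle) ≠ a) : IsInterval (insert (primaryArc a b) D) x y := by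
  have key : ∀ z ∈ Ioo x y, ∀ w ∈ Ioo a b, (z : UnitAddCircle) ≠ w := by
    intro z hz w hw hzw
    obtain ⟨n, hn⟩ := coe_eq_coe_iff.1 hzw
    have := (h.translate n).eq_of_overlap h' (z := z)
      ⟨by linarith [hw.1], by linarith [hw.2]⟩ hz
    exact hne (by rw [this, coe_add_int])
  refine ⟨h'.1, mem_vertices_insert_primaryArc.2 (.inr (.inr h'.2.1)),
    mem_vertices_insert_primaryArc.2 (.inr (.inr h'.2.2.1)), fun z hz hzv => ?_⟩
  rcases mem_vertices_insert_primaryArc.1 hzv with hz' | hz' | hz'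
  · exact key z hz _ ⟨by linarith [h.1], by linarith [h.1]⟩ hz'
  · exact key z hz _ ⟨by linarith [h.1], by linarith [h.1]⟩ hz'
  · exact h'.2.2.2 z hz hz'

/-- An interval has length at most one, so a new vertex that is congruent to a point of `(x, y)` is
equal to it. -/
theorem IsInterval.insert_sub (h : IsInterval D a b) {x y : ℝ} (hax : a ≤ x) (hxy : x < y)
    (hyb : y ≤ b) (hx : (x : UnitAddCircle) ∈ vertices (insert (primaryArc a b) D))
    (hy : (y : UnitAddCircle) ∈ vertices (insert (primaryArc a b) D))
    (h1 : a + (b - a) / 4 ∉ Ioo x y) (h2 : a + 3 * (b - a) / 4 ∉ Ioo x y) :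
    IsInterval (insert (primaryArc a b) D) x y := by
  have hlt := h.1
  have hle := h.le_add_one
  refine ⟨hxy, hx, hy, fun z hz hzv => ?_⟩
  rcases mem_vertices_insert_primaryArc.1 hzv with hz' | hz' | hz'
  · have := eq_of_coe_eq hz' (by linarith [hz.2]) (by linarith [hz.1])
    exact h1 (this ▸ hz)
  · have := eq_of_coe_eq hz' (by linarith [hz.2]) (by linarith [hz.1])
    exact h2 (this ▸ hz)
  · exact h.2.2.2 z ⟨by linarith [hz.1], by linarith [hz.2]⟩ hz'

theorem IsInterval.insert_left (h : IsInterval D a b) :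
    IsInterval (insert (primaryArc a b) D) a (a + (b - a) / 4) :=
  h.insert_sub le_rfl (by linarith [h.1]) (by linarith [h.1])
    (mem_vertices_insert_primaryArc.2 (.inr (.inr h.2.1)))
    (mem_vertices_insert_primaryArc.2 (.inl rfl))
    (fun hz => by linarith [h.1, hz.2]) (fun hz => by linarith [h.1, hz.2])

theorem IsInterval.insert_middle (h : IsInterval D a b) :
    IsInterval (insert (primaryArc a b) D) (a + (b - a) / 4) (a + 3 * (b - a) / 4) :=
  h.insert_sub (by linarith [h.1]) (by linarith [h.1]) (by linarith [h.1])
    (mem_vertices_insert_primaryArc.2 (.inl rfl))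
    (mem_vertices_insert_primaryArc.2 (.inr (.inl rfl)))
    (fun hz => by linarith [h.1, hz.1]) (fun hz => by linarith [h.1, hz.2])

theorem IsInterval.insert_right (h : IsInterval D a b) :
    IsInterval (insert (primaryArc a b) D) (a + 3 * (b - a) / 4) b :=
  h.insert_sub (by linarith [h.1]) (by linarith [h.1]) le_rfl
    (mem_vertices_insert_primaryArc.2 (.inr (.inl rfl)))
    (mem_vertices_insert_primaryArc.2 (.inr (.inr h.2.2.1)))
    (fun hz => by linarith [h.1, hz.1]) (fun hz => by linarith [h.1, hz.1])

/-- An interval is determined by either endpoint. If the left endpoint is neither `a` nor new, a new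
right endpoint would force the left one to be `a` or the first new vertex, so both endpoints are
old. -/
theorem IsInterval.of_insert (h : IsInterval D a b)
    (h' : IsInterval (insert (primaryArc a b) D) x y) :
    (IsInterval D x y ∧ (x : UnitAddCircle) ≠ a) ∨
      ∃ n : ℤ, (x = a + n ∧ y = a + (b - a) / 4 + n) ∨
        (x = a + (b - a) / 4 + n ∧ y = a + 3 * (b - a) / 4 + n) ∨
        (x = a + 3 * (b - a) / 4 + n ∧ y = b + n) := by
  by_cases hxa : (x : UnitAddCircle) = a
  · obtain ⟨n, rfl⟩ := coe_eq_coe_iff.1 hxa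
    exact .inr ⟨n, .inl ⟨rfl, h'.right_unique (h.insert_left.translate n)⟩⟩
  rcases mem_vertices_insert_primaryArc.1 h'.2.1 with hx | hx | hx
  · obtain ⟨n, rfl⟩ := coe_eq_coe_iff.1 hx
    exact .inr ⟨n, .inr (.inl ⟨rfl, h'.right_unique (h.insert_middle.translate n)⟩)⟩
  · obtain ⟨n, rfl⟩ := coe_eq_coe_iff.1 hx
    exact .inr ⟨n, .inr (.inr ⟨rfl, h'.right_unique (h.insert_right.translate n)⟩)⟩
  refine .inl ⟨⟨h'.1, hx, ?_, fun z hz hzv => h'.2.2.2 z hz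
    (mem_vertices_insert_primaryArc.2 (.inr (.inr hzv)))⟩, hxa⟩
  rcases mem_vertices_insert_primaryArc.1 h'.2.2.1 with hy | hy | hy
  · obtain ⟨n, rfl⟩ := coe_eq_coe_iff.1 hy
    exact absurd (by rw [h'.left_unique (h.insert_left.translate n), coe_add_int]) hxa
  · obtain ⟨n, rfl⟩ := coe_eq_coe_iff.1 hy
    rw [h'.left_unique (h.insert_middle.translate n), coe_add_int] at hx
    exact absurd hx h.notMem_quarter
  · exact hy

end Intervals

theorem exists_interval_insert {D : Set Arc} {a b : ℝ} (h : IsInterval D a b)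
    (hD : ∀ p ∈ vertices D, ∃ a b : ℝ, IsInterval D a b ∧ (a : UnitAddCircle) = p) :
    ∀ p ∈ vertices (insert (primaryArc a b) D),
      ∃ c d : ℝ, IsInterval (insert (primaryArc a b) D) c d ∧ (c : UnitAddCircle) = p := by
  intro p hp
  rcases mem_vertices_insert_primaryArc.1 hp with rfl | rfl | hp
  · exact ⟨_, _, h.insert_middle, rfl⟩
  · exact ⟨_, _, h.insert_right, rfl⟩
  · obtain ⟨c, d, hcd, rfl⟩ := hD p hp
    by_cases hca : (c : UnitAddCircle) = a
    · exact ⟨_, _, h.insert_left, hca.symm⟩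
    · exact ⟨_, _, h.insert_of_ne hcd hca, rfl⟩

/-- The single arc joining `1/6` to `5/6`. -/
noncomputable def rootDiagram : Set Arc :=
  {s(((1 / 6 : ℝ) : UnitAddCircle), ((5 / 6 : ℝ) : UnitAddCircle))}

theorem coe_seven_sixths : ((7 / 6 : ℝ) : UnitAddCircle) = ((1 / 6 : ℝ) : UnitAddCircle) :=
  coe_eq_coe_iff.2 ⟨1, by norm_num⟩

theorem mem_vertices_rootDiagram {p : UnitAddCircle} :
    p ∈ vertices rootDiagram ↔
      p = ((1 / 6 : ℝ) : UnitAddCircle) ∨ p = ((5 / 6 : ℝ) : UnitAddCircle) := by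
  simp [vertices, rootDiagram]

theorem isInterval_rootDiagram_left : IsInterval rootDiagram (1 / 6) (5 / 6) := by
  refine ⟨by norm_num, mem_vertices_rootDiagram.2 (.inl rfl),
    mem_vertices_rootDiagram.2 (.inr rfl), fun x hx hv => ?_⟩
  rcases mem_vertices_rootDiagram.1 hv with h | h
  · have := eq_of_coe_eq h (by linarith [hx.2]) (by linarith [hx.1])
    linarith [hx.1]
  · have := eq_of_coe_eq h (by linarith [hx.2]) (by linarith [hx.1])
    linarith [hx.2]

theorem isInterval_rootDiagram_right : IsInterval rootDiagram (5 / 6) (7 / 6) := by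
  refine ⟨by norm_num, mem_vertices_rootDiagram.2 (.inr rfl),
    mem_vertices_rootDiagram.2 (.inl coe_seven_sixths), fun x hx hv => ?_⟩
  rcases mem_vertices_rootDiagram.1 hv with h | h
  · have := eq_of_coe_eq (h.trans coe_seven_sixths.symm) (by linarith [hx.2]) (by linarith [hx.1])
    linarith [hx.2]
  · have := eq_of_coe_eq h (by linarith [hx.2]) (by linarith [hx.1])
    linarith [hx.1]

theorem primaryArc_root : primaryArc (1 / 6) (5 / 6) =
    s(((1 / 3 : ℝ) : UnitAddCircle), ((2 / 3 : ℝ) : UnitAddCircle)) := by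
  rw [primaryArc]; norm_num

/-- The base diagram becomes one more expansion, so inductions can reuse the expansion step and
start from a single arc with two intervals. -/
theorem baseDiagram_eq : baseDiagram = insert (primaryArc (1 / 6) (5 / 6)) rootDiagram := by
  rw [primaryArc_root]; rfl

/-- The next vertex is produced by induction on expansions, which avoids any appeal to finiteness
and circular order. -/
theorem IsArcDiagram.exists_interval {D : Set Arc} (hD : IsArcDiagram D) :
    ∀ p ∈ vertices D, ∃ a b : ℝ, IsInterval D a b ∧ (a : UnitAddCircle) = p := by
  induction hD with
  | base =>
    rw [baseDiagram_eq]
    refine exists_interval_insert isInterval_rootDiagram_left fun p hp => ?_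
    rcases mem_vertices_rootDiagram.1 hp with rfl | rfl
    · exact ⟨_, _, isInterval_rootDiagram_left, rfl⟩
    · exact ⟨_, _, isInterval_rootDiagram_right, rfl⟩
  | expand hD hab ih => exact exists_interval_insert hab ih

/-! ### Linear maps between intervals -/

/-- The circle homeomorphism `f` maps `[a, b]` linearly onto `[c, d]`. -/
def MapsLinearly (f : UnitAddCircle ≃ₜ UnitAddCircle) (a b c d : ℝ) : Prop :=
  ∀ t ∈ Icc (0 : ℝ) 1,
    f ((a + t * (b - a) : ℝ) : UnitAddCircle) = ((c + t * (d - c) : ℝ) : UnitAddCircle)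

namespace MapsLinearly

variable {f g : UnitAddCircle ≃ₜ UnitAddCircle} {a b c d x y : ℝ}

theorem left (h : MapsLinearly f a b c d) : f (a : UnitAddCircle) = c := by
  simpa using h 0 (by simp)

theorem right (h : MapsLinearly f a b c d) : f (b : UnitAddCircle) = d := by
  simpa using h 1 (by simp)

theorem mul (hg : MapsLinearly g c d x y) (hf : MapsLinearly f a b c d) :
    MapsLinearly (g * f) a b x y := fun t ht => by
  rw [Homeomorph.mul_apply, hf t ht, hg t ht]

theorem inv (hf : MapsLinearly f a b c d) : MapsLinearly f⁻¹ c d a b := fun t ht => by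
  rw [← hf t ht]
  exact f.symm_apply_apply _

theorem domain_translate (h : MapsLinearly f a b c d) (n : ℤ) :
    MapsLinearly f (a + n) (b + n) c d := fun t ht => by
  rw [← h t ht, ← coe_add_int (a + t * (b - a)) n]
  congr 2
  ring

theorem range_translate (h : MapsLinearly f a b c d) (n : ℤ) :
    MapsLinearly f a b (c + n) (d + n) := fun t ht => by
  rw [h t ht, ← coe_add_int (c + t * (d - c)) n]
  congr 1
  ring

theorem sub (h : MapsLinearly f a b c d) {u v : ℝ} (hu : 0 ≤ u) (huv : u ≤ v) (hv : v ≤ 1) :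
    MapsLinearly f (a + u * (b - a)) (a + v * (b - a)) (c + u * (d - c)) (c + v * (d - c)) :=
  fun t ht => by
  have h1 : t * (v - u) ≤ 1 * (v - u) := mul_le_mul_of_nonneg_right ht.2 (by linarith)
  have h2 : 0 ≤ t * (v - u) := mul_nonneg ht.1 (by linarith)
  have := h (u + t * (v - u)) ⟨by linarith, by linarith⟩
  convert this using 2 <;> ring_nf

theorem left_quarter (h : MapsLinearly f a b c d) :
    MapsLinearly f a (a + (b - a) / 4) c (c + (d - c) / 4) := by
  convert h.sub (u := 0) (v := 1 / 4) (by norm_num) (by norm_num) (by norm_num) using 1 <;> ring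

theorem middle_half (h : MapsLinearly f a b c d) :
    MapsLinearly f (a + (b - a) / 4) (a + 3 * (b - a) / 4) (c + (d - c) / 4)
      (c + 3 * (d - c) / 4) := by
  convert h.sub (u := 1 / 4) (v := 3 / 4) (by norm_num) (by norm_num) (by norm_num) using 1 <;>
    ring

theorem right_quarter (h : MapsLinearly f a b c d) :
    MapsLinearly f (a + 3 * (b - a) / 4) b (c + 3 * (d - c) / 4) d := by
  convert h.sub (u := 3 / 4) (v := 1) (by norm_num) (by norm_num) (by norm_num) using 1 <;> ring

theorem map_primaryArc (h : MapsLinearly f a b c d) :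
    Sym2.map f (primaryArc a b) = primaryArc c d := by
  rw [primaryArc, Sym2.map_mk, h.middle_half.left, h.middle_half.right, primaryArc]

theorem of_fixed (h : ∀ x ∈ Icc a b, f (x : UnitAddCircle) = x) (hab : a ≤ b) :
    MapsLinearly f a b a b := fun t ht => by
  refine h _ ⟨?_, ?_⟩
  · nlinarith [ht.1]
  · nlinarith [ht.2]

theorem exists_eq (h : MapsLinearly f a b c d) (hcd : c < d) {y : ℝ} (hy : y ∈ Ioo c d)
    (hab : a < b) : ∃ x ∈ Ioo a b, f (x : UnitAddCircle) = y := by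
  have hdc : 0 < d - c := by linarith
  have h0 : 0 < (y - c) / (d - c) := div_pos (by linarith [hy.1]) hdc
  have h1 : (y - c) / (d - c) < 1 := (div_lt_one hdc).2 (by linarith [hy.2])
  refine ⟨a + (y - c) / (d - c) * (b - a), ⟨?_, ?_⟩, ?_⟩
  · nlinarith
  · nlinarith
  · rw [h _ ⟨h0.le, h1.le⟩]
    congr 1
    field_simp
    ring

theorem eq_self (h : MapsLinearly f a b a b) (hab : a < b) {x : ℝ} (hx : x ∈ Icc a b) :
    f (x : UnitAddCircle) = x := by
  have hba : 0 < b - a := by linarith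
  have := h ((x - a) / (b - a))
    ⟨div_nonneg (by linarith [hx.1]) hba.le, (div_le_one hba).2 (by linarith [hx.2])⟩
  have e : a + (x - a) / (b - a) * (b - a) = x := by field_simp; ring
  rwa [e] at this

end MapsLinearly

/-! ### Homeomorphisms carrying one diagram to another -/

/-- The homeomorphism `f` sends the arcs of `D` onto the arcs of `R`, and every interval of `D`
linearly onto an interval of `R`. -/
structure Carries (f : UnitAddCircle ≃ₜ UnitAddCircle) (D R : Set Arc) : Prop where
  arcs : Sym2.map f '' D = R
  intervals : ∀ a b, IsInterval D a b → ∃ c d, IsInterval R c d ∧ MapsLinearly f a b c d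

namespace Carries

variable {f g : UnitAddCircle ≃ₜ UnitAddCircle} {D R S : Set Arc}

theorem mul (hg : Carries g R S) (hf : Carries f D R) : Carries (g * f) D S where
  arcs := by
    rw [← hg.arcs, ← hf.arcs, image_image]
    exact image_congr fun A _ => by rw [Sym2.map_map]; rfl
  intervals a b h := by
    obtain ⟨c, d, h1, h2⟩ := hf.intervals a b h
    obtain ⟨x, y, h3, h4⟩ := hg.intervals c d h1
    exact ⟨x, y, h3, h4.mul h2⟩

theorem map_mem_iff (hf : Carries f D R) {x y : UnitAddCircle} :
    s(f x, f y) ∈ R ↔ s(x, y) ∈ D := by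
  rw [← hf.arcs, ← Sym2.map_mk, (Sym2.map.injective f.injective).mem_set_image]

theorem map_mem_vertices_iff (hf : Carries f D R) {x : UnitAddCircle} :
    f x ∈ vertices R ↔ x ∈ vertices D := by
  constructor
  · rintro ⟨A, hA, hx⟩
    rw [← hf.arcs] at hA
    obtain ⟨B, hB, rfl⟩ := hA
    obtain ⟨y, hy, hyx⟩ := Sym2.mem_map.1 hx
    exact ⟨B, hB, f.injective hyx ▸ hy⟩
  · rintro ⟨A, hA, hx⟩
    exact ⟨_, hf.arcs ▸ mem_image_of_mem _ hA, Sym2.mem_map.2 ⟨x, hx, rfl⟩⟩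

/-- The image interval provided by `intervals` starts at the same point of the circle as `[c, d]`,
hence is an integer translate of it. -/
theorem mapsLinearly (hf : Carries f D R) {a b c d : ℝ} (hab : IsInterval D a b)
    (hcd : IsInterval R c d) (h : f (a : UnitAddCircle) = c) : MapsLinearly f a b c d := by
  obtain ⟨x, y, h1, h2⟩ := hf.intervals a b hab
  obtain ⟨n, rfl⟩ := coe_eq_coe_iff.1 (h.symm.trans h2.left)
  rw [hcd.right_unique (h1.translate n)]
  exact h2.range_translate n

/-- That `D` is an arc diagram serves to find an interval starting at the preimage of `c`. -/
theorem inv (hD : IsArcDiagram D) (hf : Carries f D R) : Carries f⁻¹ R D where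
  arcs := by
    rw [← hf.arcs, image_image]
    conv_rhs => rw [← image_id D]
    refine image_congr fun A _ => ?_
    rw [Sym2.map_map]
    have : (⇑f⁻¹ ∘ ⇑f) = id := funext f.symm_apply_apply
    rw [this, Sym2.map_id]
  intervals c d h := by
    have hc : f (f⁻¹ c) = (c : UnitAddCircle) := f.apply_symm_apply _
    obtain ⟨a, b, hab, ha⟩ := hD.exists_interval _
      (hf.map_mem_vertices_iff.1 (hc.symm ▸ h.2.1 : f (f⁻¹ c) ∈ vertices R))
    exact ⟨a, b, hab, (hf.mapsLinearly hab h (by rw [ha, hc])).inv⟩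

/-- A linear map respects the ratios 1 : 2 : 1, so it takes primary arc to primary arc and the three
new pieces to the three new pieces. -/
theorem insert_primaryArc (hf : Carries f D R) {a b c d : ℝ} (hab : IsInterval D a b)
    (hcd : IsInterval R c d) (h : MapsLinearly f a b c d) :
    Carries f (insert (primaryArc a b) D) (insert (primaryArc c d) R) where
  arcs := by rw [image_insert_eq, hf.arcs, h.map_primaryArc]
  intervals x y hxy := by
    rcases hab.of_insert hxy with ⟨h1, h2⟩ | ⟨n, ⟨rfl, rfl⟩ | ⟨rfl, rfl⟩ | ⟨rfl, rfl⟩⟩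
    · obtain ⟨x', y', h3, h4⟩ := hf.intervals x y h1
      refine ⟨x', y', hcd.insert_of_ne h3 fun he => h2 (f.injective ?_), h4⟩
      rw [h4.left, he, h.left]
    · exact ⟨_, _, hcd.insert_left, h.left_quarter.domain_translate n⟩
    · exact ⟨_, _, hcd.insert_middle, h.middle_half.domain_translate n⟩
    · exact ⟨_, _, hcd.insert_right, h.right_quarter.domain_translate n⟩

end Carries

/-- Every vertex starts an interval, so the inducing isomorphism is the restriction of `f` to the
vertices and can be eliminated; conversely, `f` restricted to the vertices is an isomorphism
inducing `f`. -/
theorem mem_dyadicRearrangements_iff {f : UnitAddCircle ≃ₜ UnitAddCircle} :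
    f ∈ dyadicRearrangements ↔ ∃ D R, IsArcDiagram D ∧ IsArcDiagram R ∧ Carries f D R := by
  constructor
  · rintro ⟨D, R, hD, hR, φ, hφ⟩
    have key : ∀ a b, IsInterval D a b → ∀ p : vertices D, (a : UnitAddCircle) = p →
        ∃ c d, IsInterval R c d ∧ MapsLinearly f a b c d ∧
          (c : UnitAddCircle) = φ.toEquiv p := by
      intro a b h p hp
      have := (φ.next_iff p ⟨b, h.2.2.1⟩).1 ⟨a, b, h, hp, rfl⟩
      obtain ⟨c, d, hcd, hc, hd⟩ := this
      exact ⟨c, d, hcd, hφ _ _ a b c d h hcd hp rfl hc hd, hc⟩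
    have hv : ∀ p : vertices D, f p = φ.toEquiv p := by
      intro p
      obtain ⟨a, b, hab, ha⟩ := hD.exists_interval p p.2
      obtain ⟨c, d, -, h1, h2⟩ := key a b hab p ha
      rw [← ha, h1.left, h2]
    refine ⟨D, R, hD, hR, ?_, fun a b h => ?_⟩
    · ext A
      induction A with | h x y
      constructor
      · rintro ⟨B, hB, hBA⟩
        induction B with | h p q
        rw [← hBA, Sym2.map_mk]
        have hp : p ∈ vertices D := ⟨_, hB, Sym2.mem_mk_left p q⟩
        have hq : q ∈ vertices D := ⟨_, hB, Sym2.mem_mk_right p q⟩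
        have := (φ.arc_iff ⟨p, hp⟩ ⟨q, hq⟩).1 hB
        rwa [← hv, ← hv] at this
      · intro hA
        have hx : x ∈ vertices R := ⟨_, hA, Sym2.mem_mk_left x y⟩
        have hy : y ∈ vertices R := ⟨_, hA, Sym2.mem_mk_right x y⟩
        refine ⟨s(φ.toEquiv.symm ⟨x, hx⟩, φ.toEquiv.symm ⟨y, hy⟩), ?_, ?_⟩
        · rw [φ.arc_iff]; simpa using hA
        · rw [Sym2.map_mk, hv, hv]; simp
    · obtain ⟨c, d, h1, h2, -⟩ := key a b h ⟨a, h.2.1⟩ rfl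
      exact ⟨c, d, h1, h2⟩
  · rintro ⟨D, R, hD, hR, hf⟩
    refine ⟨D, R, hD, hR, ⟨f.toEquiv.subtypeEquiv fun x => hf.map_mem_vertices_iff.symm,
      fun p q => hf.map_mem_iff.symm, fun p q => ⟨?_, ?_⟩⟩, ?_⟩
    · rintro ⟨a, b, h, ha, hb⟩
      obtain ⟨c, d, h1, h2⟩ := hf.intervals a b h
      exact ⟨c, d, h1, h2.left.symm.trans (congrArg f ha), h2.right.symm.trans (congrArg f hb)⟩
    · rintro ⟨c, d, h, hc, hd⟩
      obtain ⟨a, b, h1, h2⟩ := (hf.inv hD).intervals c d h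
      exact ⟨a, b, h1, h2.left.symm.trans ((congrArg f.symm hc).trans (f.symm_apply_apply _)),
        h2.right.symm.trans ((congrArg f.symm hd).trans (f.symm_apply_apply _))⟩
    · intro p q a b c d hab hcd ha hb hc hd
      exact hf.mapsLinearly hab hcd (by rw [ha, hc]; rfl)

/-! ### Ternary trees of subdivisions -/

/-- Ternary trees, which record iterated subdivisions of an interval in the ratios `1 : 2 : 1`. -/
inductive TernaryTree
  | leaf : TernaryTree
  | node (l m r : TernaryTree) : TernaryTree

namespace TernaryTree

/-- The intervals into which `t` subdivides `[a, b]`, in order. -/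
noncomputable def leaves : TernaryTree → ℝ → ℝ → List (ℝ × ℝ)
  | leaf, a, b => [(a, b)]
  | node l m r, a, b =>
    l.leaves a (a + (b - a) / 4) ++
      (m.leaves (a + (b - a) / 4) (a + 3 * (b - a) / 4) ++ r.leaves (a + 3 * (b - a) / 4) b)

/-- The primary arcs of the intervals of `[a, b]` that `t` subdivides. -/
noncomputable def arcs : TernaryTree → ℝ → ℝ → Set Arc
  | leaf, _, _ => ∅
  | node l m r, a, b =>
    insert (primaryArc a b) (l.arcs a (a + (b - a) / 4) ∪
      m.arcs (a + (b - a) / 4) (a + 3 * (b - a) / 4) ∪ r.arcs (a + 3 * (b - a) / 4) b)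

/-- One leaf is replaced by a node. -/
inductive Grow : TernaryTree → TernaryTree → Prop
  | leaf : Grow leaf (node leaf leaf leaf)
  | left {l l' : TernaryTree} (m r : TernaryTree) (h : Grow l l') : Grow (node l m r) (node l' m r)
  | middle {m m' : TernaryTree} (l r : TernaryTree) (h : Grow m m') :
      Grow (node l m r) (node l m' r)
  | right {r r' : TernaryTree} (l m : TernaryTree) (h : Grow r r') : Grow (node l m r) (node l m r')

/-- The complete ternary tree of depth `n`. -/
def complete : ℕ → TernaryTree
  | 0 => leaf
  | n + 1 => node (complete n) (complete n) (complete n)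

/-- The depth of a tree. -/
def depth : TernaryTree → ℕ
  | leaf => 0
  | node l m r => max l.depth (max m.depth r.depth) + 1

/-- `t'` is obtained from `t` by growing leaves. -/
abbrev Grows : TernaryTree → TernaryTree → Prop := Relation.ReflTransGen Grow

theorem Grows.node {l m r l' m' r' : TernaryTree} (hl : Grows l l') (hm : Grows m m')
    (hr : Grows r r') : Grows (node l m r) (node l' m' r') :=
  ((hl.lift (fun x => TernaryTree.node x m r) fun _ _ => .left m r).trans
    (hm.lift (fun x => TernaryTree.node l' x r) fun _ _ => .middle l' r)).trans
    (hr.lift (fun x => TernaryTree.node l' m' x) fun _ _ => .right l' m')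

theorem grows_of_leaf (t : TernaryTree) : Grows leaf t := by
  induction t with
  | leaf => exact .refl
  | node l m r hl hm hr => exact .head .leaf (hl.node hm hr)

theorem grows_complete {t : TernaryTree} {n : ℕ} (h : t.depth ≤ n) : Grows t (complete n) := by
  induction t generalizing n with
  | leaf => exact grows_of_leaf _
  | node l m r hl hm hr =>
    obtain _ | n := n
    · simp [depth] at h
    · simp only [depth, add_le_add_iff_right, max_le_iff] at h
      exact (hl h.1).node (hm h.2.1) (hr h.2.2)

variable {a b x y : ℝ}

theorem bounds_of_mem_leaves {t : TernaryTree} (hab : a < b) (h : (x, y) ∈ t.leaves a b) :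
    a ≤ x ∧ x < y ∧ y ≤ b := by
  induction t generalizing a b with
  | leaf =>
    simp only [leaves, List.mem_singleton, Prod.mk.injEq] at h
    obtain ⟨rfl, rfl⟩ := h
    exact ⟨le_rfl, hab, le_rfl⟩
  | node l m r hl hm hr =>
    simp only [leaves, List.mem_append] at h
    rcases h with h | h | h
    · obtain ⟨h1, h2, h3⟩ := hl (by linarith) h
      exact ⟨by linarith, h2, by linarith⟩
    · obtain ⟨h1, h2, h3⟩ := hm (by linarith) h
      exact ⟨by linarith, h2, by linarith⟩
    · obtain ⟨h1, h2, h3⟩ := hr (by linarith) h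
      exact ⟨by linarith, h2, by linarith⟩

theorem exists_first_leaf (t : TernaryTree) (a b : ℝ) : ∃ y, (a, y) ∈ t.leaves a b := by
  induction t generalizing a b with
  | leaf => exact ⟨b, by simp [leaves]⟩
  | node l m r hl hm hr =>
    obtain ⟨y, hy⟩ := hl a (a + (b - a) / 4)
    exact ⟨y, by simp [leaves, hy]⟩

theorem exists_leaf_mem (t : TernaryTree) {z : ℝ} (hz : z ∈ Icc a b) :
    ∃ I ∈ t.leaves a b, z ∈ Icc I.1 I.2 := by
  induction t generalizing a b with
  | leaf => exact ⟨(a, b), by simp [leaves], hz⟩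
  | node l m r hl hm hr =>
    simp only [leaves, List.mem_append]
    rcases le_total z (a + (b - a) / 4) with h | h
    · obtain ⟨I, hI, h'⟩ := hl ⟨hz.1, h⟩
      exact ⟨I, .inl hI, h'⟩
    rcases le_total z (a + 3 * (b - a) / 4) with h1 | h1
    · obtain ⟨I, hI, h'⟩ := hm ⟨h, h1⟩
      exact ⟨I, .inr (.inl hI), h'⟩
    · obtain ⟨I, hI, h'⟩ := hr ⟨h1, hz.2⟩
      exact ⟨I, .inr (.inr hI), h'⟩

theorem exists_leaf_of_mem_vertices {t : TernaryTree} {p : UnitAddCircle}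
    (hp : p ∈ vertices (t.arcs a b)) : ∃ x y, (x, y) ∈ t.leaves a b ∧ (x : UnitAddCircle) = p := by
  induction t generalizing a b with
  | leaf => simp [arcs, vertices] at hp
  | node l m r hl hm hr =>
    simp only [leaves, List.mem_append]
    obtain ⟨A, (rfl | (hA | hA) | hA), hpA⟩ := hp
    · rcases Sym2.mem_iff.1 hpA with rfl | rfl
      · obtain ⟨y, hy⟩ := m.exists_first_leaf (a + (b - a) / 4) (a + 3 * (b - a) / 4)
        exact ⟨_, y, .inr (.inl hy), rfl⟩
      · obtain ⟨y, hy⟩ := r.exists_first_leaf (a + 3 * (b - a) / 4) b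
        exact ⟨_, y, .inr (.inr hy), rfl⟩
    · obtain ⟨x, y, h, rfl⟩ := hl ⟨A, hA, hpA⟩
      exact ⟨x, y, .inl h, rfl⟩
    · obtain ⟨x, y, h, rfl⟩ := hm ⟨A, hA, hpA⟩
      exact ⟨x, y, .inr (.inl h), rfl⟩
    · obtain ⟨x, y, h, rfl⟩ := hr ⟨A, hA, hpA⟩
      exact ⟨x, y, .inr (.inr h), rfl⟩

/-- Together with `exists_grow_of_mem_leaves` this is the dictionary between growing a leaf and
adding a primary arc. -/
theorem Grow.exists_leaf {t t' : TernaryTree} (h : Grow t t') (a b : ℝ) :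
    ∃ x y, (x, y) ∈ t.leaves a b ∧ t'.arcs a b = insert (primaryArc x y) (t.arcs a b) := by
  induction h generalizing a b with
  | leaf => exact ⟨a, b, by simp [leaves], by simp [arcs]⟩
  | left m r h ih =>
    obtain ⟨x, y, h1, h2⟩ := ih a (a + (b - a) / 4)
    refine ⟨x, y, by simp [leaves, h1], ?_⟩
    simp only [arcs, h2, insert_union, insert_comm (primaryArc x y)]
  | middle l r h ih =>
    obtain ⟨x, y, h1, h2⟩ := ih (a + (b - a) / 4) (a + 3 * (b - a) / 4)
    refine ⟨x, y, by simp [leaves, h1], ?_⟩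
    simp only [arcs, h2, insert_union, union_insert, insert_comm (primaryArc x y)]
  | right l m h ih =>
    obtain ⟨x, y, h1, h2⟩ := ih (a + 3 * (b - a) / 4) b
    refine ⟨x, y, by simp [leaves, h1], ?_⟩
    simp only [arcs, h2, union_insert, insert_comm (primaryArc x y)]

theorem exists_grow_of_mem_leaves {t : TernaryTree} (h : (x, y) ∈ t.leaves a b) :
    ∃ t', Grow t t' ∧ t'.arcs a b = insert (primaryArc x y) (t.arcs a b) := by
  induction t generalizing a b with
  | leaf =>
    simp only [leaves, List.mem_singleton, Prod.mk.injEq] at h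
    obtain ⟨rfl, rfl⟩ := h
    exact ⟨_, .leaf, by simp [arcs]⟩
  | node l m r hl hm hr =>
    simp only [leaves, List.mem_append] at h
    rcases h with h | h | h
    · obtain ⟨t', h1, h2⟩ := hl h
      refine ⟨_, h1.left m r, ?_⟩
      simp only [arcs, h2, insert_union, insert_comm (primaryArc x y)]
    · obtain ⟨t', h1, h2⟩ := hm h
      refine ⟨_, h1.middle l r, ?_⟩
      simp only [arcs, h2, insert_union, union_insert, insert_comm (primaryArc x y)]
    · obtain ⟨t', h1, h2⟩ := hr h
      refine ⟨_, h1.right l m, ?_⟩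
      simp only [arcs, h2, union_insert, insert_comm (primaryArc x y)]

/-- Subdividing the interval `[a, b]` of `D` according to `t` keeps the other intervals of `D` and
adds the leaves of `t`. -/
theorem isInterval_union_arcs (t : TernaryTree) {D : Set Arc} (h : IsInterval D a b) :
    (∀ x y, IsInterval D x y → (x : UnitAddCircle) ≠ a → IsInterval (D ∪ t.arcs a b) x y) ∧
      ∀ x y, (x, y) ∈ t.leaves a b → IsInterval (D ∪ t.arcs a b) x y := by
  induction t generalizing a b D with
  | leaf =>
    simp only [arcs, union_empty, leaves, List.mem_singleton, Prod.mk.injEq]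
    exact ⟨fun x y hxy _ => hxy, fun x y ⟨hx, hy⟩ => hx ▸ hy ▸ h⟩
  | node l m r hl hm hr =>
    have hlt := h.1
    have hle := h.le_add_one
    have ne1 : ((a + (b - a) / 4 : ℝ) : UnitAddCircle) ≠ a :=
      fun he => h.notMem_quarter (he ▸ h.2.1)
    have ne2 : ((a + 3 * (b - a) / 4 : ℝ) : UnitAddCircle) ≠ a :=
      fun he => h.notMem_three_quarter (he ▸ h.2.1)
    have ne3 : ((a + 3 * (b - a) / 4 : ℝ) : UnitAddCircle) ≠ ((a + (b - a) / 4 : ℝ) :) :=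
      fun he => by
        have := eq_of_coe_eq he (by linarith) (by linarith)
        linarith
    have e : D ∪ (node l m r).arcs a b = insert (primaryArc a b) D ∪ l.arcs a (a + (b - a) / 4) ∪
        m.arcs (a + (b - a) / 4) (a + 3 * (b - a) / 4) ∪ r.arcs (a + 3 * (b - a) / 4) b := by
      simp only [arcs, insert_union, union_insert, union_assoc]
    -- The three pieces are subdivided one after another; each stage keeps the pieces still to be
    -- treated, because their left endpoints differ from that of the piece being subdivided.
    obtain ⟨l1, l2⟩ := hl h.insert_left
    have hm' := l1 _ _ h.insert_middle ne1
    obtain ⟨m1, m2⟩ := hm hm'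
    obtain ⟨r1, r2⟩ := hr (m1 _ _ (l1 _ _ h.insert_right ne2) ne3)
    rw [e]
    refine ⟨fun x y hxy hne => ?_, fun x y hxy => ?_⟩
    · exact r1 _ _ (m1 _ _ (l1 _ _ (h.insert_of_ne hxy hne) hne)
        fun he => h.notMem_quarter (he ▸ hxy.2.1)) fun he => h.notMem_three_quarter (he ▸ hxy.2.1)
    · simp only [leaves, List.mem_append] at hxy
      rcases hxy with hxy | hxy | hxy
      · obtain ⟨h1, h2, h3⟩ := bounds_of_mem_leaves (by linarith) hxy
        refine r1 _ _ (m1 _ _ (l2 _ _ hxy) fun he => ?_) fun he => ?_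
        · have := eq_of_coe_eq he (by linarith) (by linarith)
          linarith
        · have := eq_of_coe_eq he (by linarith) (by linarith)
          linarith
      · obtain ⟨h1, h2, h3⟩ := bounds_of_mem_leaves (by linarith) hxy
        refine r1 _ _ (m2 _ _ hxy) fun he => ?_
        have := eq_of_coe_eq he (by linarith) (by linarith)
        linarith
      · exact r2 _ _ hxy

end TernaryTree

open TernaryTree

/-! ### Arc diagrams as pairs of trees -/

/-- The diagram in which `[1/6, 5/6]` and `[5/6, 7/6]` are subdivided according to `s` and `t`. -/
noncomputable def treeDiagram (s t : TernaryTree) : Set Arc :=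
  rootDiagram ∪ s.arcs (1 / 6) (5 / 6) ∪ t.arcs (5 / 6) (7 / 6)

section TreeDiagram

variable {s t s' t' : TernaryTree} {x y : ℝ}

theorem coe_five_sixths_ne : ((5 / 6 : ℝ) : UnitAddCircle) ≠ ((1 / 6 : ℝ) : UnitAddCircle) :=
  fun he => by
    have := eq_of_coe_eq he (by norm_num) (by norm_num)
    norm_num at this

theorem isInterval_of_mem_leaves
    (h : (x, y) ∈ s.leaves (1 / 6) (5 / 6) ∨ (x, y) ∈ t.leaves (5 / 6) (7 / 6)) :
    IsInterval (treeDiagram s t) x y := by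
  obtain ⟨s1, s2⟩ := s.isInterval_union_arcs isInterval_rootDiagram_left
  obtain ⟨t1, t2⟩ := t.isInterval_union_arcs
    (s1 _ _ isInterval_rootDiagram_right coe_five_sixths_ne)
  rcases h with h | h
  · refine t1 _ _ (s2 _ _ h) fun he => ?_
    obtain ⟨h1, h2, h3⟩ := bounds_of_mem_leaves (by norm_num) h
    have := eq_of_coe_eq he (by linarith) (by linarith)
    linarith
  · exact t2 _ _ h

/-- Every vertex is the left endpoint of a leaf, and the left endpoint determines the interval. -/
theorem exists_leaf_of_isInterval (h : IsInterval (treeDiagram s t) x y) :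
    ∃ u v : ℝ, ∃ n : ℤ, x = u + n ∧ y = v + n ∧
      ((u, v) ∈ s.leaves (1 / 6) (5 / 6) ∨ (u, v) ∈ t.leaves (5 / 6) (7 / 6)) := by
  have key : ∃ u v : ℝ, (x : UnitAddCircle) = u ∧
      ((u, v) ∈ s.leaves (1 / 6) (5 / 6) ∨ (u, v) ∈ t.leaves (5 / 6) (7 / 6)) := by
    obtain ⟨A, ((hA | hA) | hA), hx⟩ := h.2.1
    · rcases mem_vertices_rootDiagram.1 ⟨A, hA, hx⟩ with hx | hx
      · obtain ⟨v, hv⟩ := s.exists_first_leaf (1 / 6) (5 / 6)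
        exact ⟨_, v, hx, .inl hv⟩
      · obtain ⟨v, hv⟩ := t.exists_first_leaf (5 / 6) (7 / 6)
        exact ⟨_, v, hx, .inr hv⟩
    · obtain ⟨u, v, h1, h2⟩ := exists_leaf_of_mem_vertices ⟨A, hA, hx⟩
      exact ⟨u, v, h2.symm, .inl h1⟩
    · obtain ⟨u, v, h1, h2⟩ := exists_leaf_of_mem_vertices ⟨A, hA, hx⟩
      exact ⟨u, v, h2.symm, .inr h1⟩
  obtain ⟨u, v, hx, hl⟩ := key
  obtain ⟨n, rfl⟩ := coe_eq_coe_iff.1 hx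
  exact ⟨u, v, n, rfl, h.right_unique ((isInterval_of_mem_leaves hl).translate n), hl⟩

/-- A property of sets of arcs that is inherited when an interval is subdivided. -/
def StableUnderExpansion (P : Set Arc → Prop) : Prop :=
  ∀ D a b, P D → IsInterval D a b → P (insert (primaryArc a b) D)

/-- Each growth step adds the primary arc of a leaf, which is an interval of the current diagram. -/
theorem StableUnderExpansion.grows {P : Set Arc → Prop} (hP : StableUnderExpansion P)
    (hs : Grows s s') (ht : Grows t t') (h : P (treeDiagram s t)) : P (treeDiagram s' t') := by
  have h1 : P (treeDiagram s' t) := by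
    induction hs with
    | refl => exact h
    | tail _ hg ih =>
      obtain ⟨x, y, hxy, he⟩ := hg.exists_leaf (1 / 6) (5 / 6)
      rw [treeDiagram, he, union_insert, insert_union]
      exact hP _ _ _ ih (isInterval_of_mem_leaves (.inl hxy))
  induction ht with
  | refl => exact h1
  | tail _ hg ih =>
    obtain ⟨x, y, hxy, he⟩ := hg.exists_leaf (5 / 6) (7 / 6)
    rw [treeDiagram, he, union_insert]
    exact hP _ _ _ ih (isInterval_of_mem_leaves (.inr hxy))

theorem baseDiagram_eq_treeDiagram : baseDiagram = treeDiagram (node leaf leaf leaf) leaf := by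
  rw [baseDiagram_eq]
  simp [treeDiagram, arcs]

theorem isArcDiagram_treeDiagram (l m r t : TernaryTree) :
    IsArcDiagram (treeDiagram (node l m r) t) :=
  StableUnderExpansion.grows (fun _ _ _ hD hab => hD.expand hab)
    ((grows_of_leaf l).node (grows_of_leaf m) (grows_of_leaf r)) (grows_of_leaf t)
    (baseDiagram_eq_treeDiagram ▸ .base)

theorem primaryArc_translate (a b : ℝ) (n : ℤ) :
    primaryArc (a + n) (b + n) = primaryArc a b := by
  have h1 : a + n + (b + n - (a + n)) / 4 = a + (b - a) / 4 + n := by ring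
  have h2 : a + n + 3 * (b + n - (a + n)) / 4 = a + 3 * (b - a) / 4 + n := by ring
  rw [primaryArc, primaryArc, h1, h2, coe_add_int, coe_add_int]

theorem IsArcDiagram.exists_tree {D : Set Arc} (hD : IsArcDiagram D) :
    ∃ l m r t, D = treeDiagram (node l m r) t := by
  induction hD with
  | base => exact ⟨_, _, _, _, baseDiagram_eq_treeDiagram⟩
  | expand hD hab ih =>
    obtain ⟨l, m, r, t, rfl⟩ := ih
    obtain ⟨u, v, n, rfl, rfl, h | h⟩ := exists_leaf_of_isInterval hab
    · obtain ⟨s', h1, h2⟩ := exists_grow_of_mem_leaves h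
      rw [primaryArc_translate]
      have e : insert (primaryArc u v) (treeDiagram (node l m r) t) = treeDiagram s' t := by
        rw [treeDiagram, treeDiagram, h2, union_insert, insert_union]
      -- A tree grown from a node is again a node.
      cases h1 <;> exact ⟨_, _, _, _, e⟩
    · obtain ⟨t', h1, h2⟩ := exists_grow_of_mem_leaves h
      rw [primaryArc_translate]
      refine ⟨l, m, r, t', ?_⟩
      rw [treeDiagram, treeDiagram, h2, union_insert]

/-- The diagram given by two complete trees of depth `n + 1`. -/
noncomputable def completeDiagram (n : ℕ) : Set Arc :=
  treeDiagram (complete (n + 1)) (complete (n + 1))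

/-- Every sufficiently deep complete diagram is an expansion of `D`, so two diagrams share one.
Expansion is expressed here through the properties that it transmits. -/
theorem IsArcDiagram.exists_completeDiagram {D : Set Arc} (hD : IsArcDiagram D) :
    ∃ N, ∀ n ≥ N, ∀ P, StableUnderExpansion P → P D → P (completeDiagram n) := by
  obtain ⟨l, m, r, t, rfl⟩ := hD.exists_tree
  refine ⟨max (node l m r).depth t.depth, fun n hn P hP h => hP.grows ?_ ?_ h⟩
  · exact grows_complete (by omega)
  · exact grows_complete (by omega)

end TreeDiagram

/-! ### Closure under composition -/

theorem stableUnderExpansion_exists_carries (f : UnitAddCircle ≃ₜ UnitAddCircle) :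
    StableUnderExpansion fun D => IsArcDiagram D ∧ ∃ R, IsArcDiagram R ∧ Carries f D R := by
  rintro D a b ⟨hD, R, hR, hf⟩ hab
  obtain ⟨c, d, hcd, h⟩ := hf.intervals a b hab
  exact ⟨hD.expand hab, _, hR.expand hcd, hf.insert_primaryArc hab hcd h⟩

/-- The group of dyadic rearrangements of the Basilica. -/
def rearrangementGroup : Subgroup (UnitAddCircle ≃ₜ UnitAddCircle) where
  carrier := dyadicRearrangements
  mul_mem' := by
    intro g f hg hf
    obtain ⟨D, R, hD, hR, hf⟩ := mem_dyadicRearrangements_iff.1 hf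
    obtain ⟨D', R', hD', hR', hg⟩ := mem_dyadicRearrangements_iff.1 hg
    -- One complete diagram expands both the range of `f` and the domain of `g`; there `f⁻¹` and `g`
    -- are both linear on intervals, and the composite passes through it.
    obtain ⟨N, hN⟩ := hR.exists_completeDiagram
    obtain ⟨N', hN'⟩ := hD'.exists_completeDiagram
    obtain ⟨hC, E, hE, h1⟩ := hN (max N N') (le_max_left _ _) _
      (stableUnderExpansion_exists_carries f⁻¹) ⟨hR, D, hD, hf.inv hD⟩
    obtain ⟨-, E', hE', h2⟩ := hN' (max N N') (le_max_right _ _) _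
      (stableUnderExpansion_exists_carries g) ⟨hD', R', hR', hg⟩
    have h3 := h1.inv hC
    rw [inv_inv] at h3
    exact mem_dyadicRearrangements_iff.2 ⟨E, E', hE, hE', h2.mul h3⟩
  one_mem' := mem_dyadicRearrangements_iff.2 ⟨baseDiagram, baseDiagram, .base, .base,
    ⟨by
      have : (⇑(1 : UnitAddCircle ≃ₜ UnitAddCircle)) = id := rfl
      rw [this, Sym2.map_id, image_id], fun a b h => ⟨a, b, h, fun _ _ => rfl⟩⟩⟩
  inv_mem' := by
    intro f hf
    obtain ⟨D, R, hD, hR, hf⟩ := mem_dyadicRearrangements_iff.1 hf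
    exact mem_dyadicRearrangements_iff.2 ⟨R, D, hR, hD, hf.inv hD⟩

/-! ### The generators -/

section Generators

variable {a x y x' y' : ℝ} {F : ℝ → ℝ} {hc : Continuous F}
  {hm : StrictMonoOn F (Icc a (a + 1))} {hp : F (a + 1) = F a + 1}

theorem circleHomeo_apply_of_mem_Icc (hx : x ∈ Icc a (a + 1)) :
    circleHomeo a F hc hm hp (x : UnitAddCircle) = (F x : UnitAddCircle) := by
  rcases hx.2.lt_or_eq with h | rfl
  · exact circleHomeo_apply ⟨hx.1, h⟩
  · have h1 : ((a + 1 : ℝ) : UnitAddCircle) = a := by simp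
    have h2 : ((F a + 1 : ℝ) : UnitAddCircle) = F a := by simp
    rw [h1, hp, h2]
    exact circleHomeo_apply ⟨le_rfl, by linarith⟩

theorem circleHomeo_mapsLinearly (k m : ℝ) (hx : a ≤ x) (hxy : x ≤ y) (hy : y ≤ a + 1)
    (hF : ∀ z ∈ Icc x y, F z = k * z + m) (hx' : x' = k * x + m) (hy' : y' = k * y + m) :
    MapsLinearly (circleHomeo a F hc hm hp) x y x' y' := fun t ht => by
  have h1 : 0 ≤ t * (y - x) := mul_nonneg ht.1 (by linarith)
  have h2 : t * (y - x) ≤ 1 * (y - x) := mul_le_mul_of_nonneg_right ht.2 (by linarith)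
  rw [circleHomeo_apply_of_mem_Icc ⟨by linarith, by linarith⟩, hF _ ⟨by linarith, by linarith⟩,
    hx', hy']
  congr 1
  ring

theorem alpha_mapsLinearly_left (hx : 1 / 3 ≤ x) (hxy : x ≤ y) (hy : y ≤ 2 / 3)
    (hx' : x' = 2 * x - 1 / 2) (hy' : y' = 2 * y - 1 / 2) : MapsLinearly alpha x y x' y' :=
  circleHomeo_mapsLinearly 2 (-1 / 2) hx hxy (by linarith)
    (fun z hz => by have := hz.1; have := hz.2; simp only [alphaLift]; split_ifs <;> linarith)
    (by linarith) (by linarith)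

theorem alpha_mapsLinearly_right (hx : 2 / 3 ≤ x) (hxy : x ≤ y) (hy : y ≤ 4 / 3)
    (hx' : x' = x / 2 + 1 / 2) (hy' : y' = y / 2 + 1 / 2) : MapsLinearly alpha x y x' y' :=
  circleHomeo_mapsLinearly (1 / 2) (1 / 2) (by linarith) hxy (by linarith)
    (fun z hz => by have := hz.1; have := hz.2; simp only [alphaLift]; split_ifs <;> linarith)
    (by linarith) (by linarith)

theorem beta_mapsLinearly_first (hx : 1 / 6 ≤ x) (hxy : x ≤ y) (hy : y ≤ 2 / 3)
    (hx' : x' = x / 4 + 1 / 8) (hy' : y' = y / 4 + 1 / 8) : MapsLinearly beta x y x' y' :=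
  circleHomeo_mapsLinearly (1 / 4) (1 / 8) (by linarith) hxy (by linarith)
    (fun z hz => by have := hz.1; have := hz.2; simp only [betaLift]; split_ifs <;> linarith)
    (by linarith) (by linarith)

theorem beta_mapsLinearly_second (hx : 2 / 3 ≤ x) (hxy : x ≤ y) (hy : y ≤ 17 / 24)
    (hx' : x' = x - 3 / 8) (hy' : y' = y - 3 / 8) : MapsLinearly beta x y x' y' :=
  circleHomeo_mapsLinearly 1 (-3 / 8) (by linarith) hxy (by linarith)
    (fun z hz => by have := hz.1; have := hz.2; simp only [betaLift]; split_ifs <;> linarith)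
    (by linarith) (by linarith)

theorem beta_mapsLinearly_third (hx : 17 / 24 ≤ x) (hxy : x ≤ y) (hy : y ≤ 5 / 6)
    (hx' : x' = 4 * x - 5 / 2) (hy' : y' = 4 * y - 5 / 2) : MapsLinearly beta x y x' y' :=
  circleHomeo_mapsLinearly 4 (-5 / 2) (by linarith) hxy (by linarith)
    (fun z hz => by have := hz.1; have := hz.2; simp only [betaLift]; split_ifs <;> linarith)
    (by linarith) (by linarith)

theorem beta_mapsLinearly_fourth (hx : 5 / 6 ≤ x) (hxy : x ≤ y) (hy : y ≤ 7 / 6) :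
    MapsLinearly beta x y x y :=
  circleHomeo_mapsLinearly 1 0 (by linarith) hxy (by linarith)
    (fun z hz => by have := hz.1; have := hz.2; simp only [betaLift]; split_ifs <;> linarith)
    (by linarith) (by linarith)

theorem gamma_mapsLinearly_first (hx : 1 / 6 ≤ x) (hxy : x ≤ y) (hy : y ≤ 7 / 24)
    (hx' : x' = x / 4 + 1 / 8) (hy' : y' = y / 4 + 1 / 8) : MapsLinearly gamma x y x' y' :=
  circleHomeo_mapsLinearly (1 / 4) (1 / 8) (by linarith) hxy (by linarith)
    (fun z hz => by have := hz.1; have := hz.2; simp only [gammaLift]; split_ifs <;> linarith)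
    (by linarith) (by linarith)

theorem gamma_mapsLinearly_second (hx : 7 / 24 ≤ x) (hxy : x ≤ y) (hy : y ≤ 29 / 96)
    (hx' : x' = x - 3 / 32) (hy' : y' = y - 3 / 32) : MapsLinearly gamma x y x' y' :=
  circleHomeo_mapsLinearly 1 (-3 / 32) (by linarith) hxy (by linarith)
    (fun z hz => by have := hz.1; have := hz.2; simp only [gammaLift]; split_ifs <;> linarith)
    (by linarith) (by linarith)

theorem gamma_mapsLinearly_third (hx : 29 / 96 ≤ x) (hxy : x ≤ y) (hy : y ≤ 1 / 3)
    (hx' : x' = 4 * x - 1) (hy' : y' = 4 * y - 1) : MapsLinearly gamma x y x' y' :=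
  circleHomeo_mapsLinearly 4 (-1) (by linarith) hxy (by linarith)
    (fun z hz => by have := hz.1; have := hz.2; simp only [gammaLift]; split_ifs <;> linarith)
    (by linarith) (by linarith)

theorem gamma_mapsLinearly_fourth (hx : 1 / 3 ≤ x) (hxy : x ≤ y) (hy : y ≤ 7 / 6) :
    MapsLinearly gamma x y x y :=
  circleHomeo_mapsLinearly 1 0 (by linarith) hxy (by linarith)
    (fun z hz => by have := hz.1; have := hz.2; simp only [gammaLift]; split_ifs <;> linarith)
    (by linarith) (by linarith)

theorem delta_mapsLinearly_add (hx' : x' = x + 1 / 2) (hy' : y' = y + 1 / 2) :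
    MapsLinearly delta x y x' y' := fun t _ => by
  rw [hx', hy']
  change ((x + t * (y - x) : ℝ) : UnitAddCircle) + ((1 / 2 : ℝ) : UnitAddCircle) = _
  rw [← AddCircle.coe_add]
  congr 1
  ring

theorem delta_mapsLinearly_sub (hx' : x' = x - 1 / 2) (hy' : y' = y - 1 / 2) :
    MapsLinearly delta x y x' y' := by
  convert (delta_mapsLinearly_add (x := x) (y := y) rfl rfl).range_translate (-1) using 1 <;>
    push_cast <;> linarith

end Generators

/-- Up to integer translation the intervals of a tree diagram are the leaves, so linearity is
checked on finitely many explicit intervals. -/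
theorem carries_treeDiagram {f : UnitAddCircle ≃ₜ UnitAddCircle} {s t s' t' : TernaryTree}
    (harcs : Sym2.map f '' treeDiagram s t = treeDiagram s' t')
    (h : ∀ x y, (x, y) ∈ s.leaves (1 / 6) (5 / 6) ∨ (x, y) ∈ t.leaves (5 / 6) (7 / 6) →
      ∃ x' y', ((x', y') ∈ s'.leaves (1 / 6) (5 / 6) ∨ (x', y') ∈ t'.leaves (5 / 6) (7 / 6)) ∧
        MapsLinearly f x y x' y') : Carries f (treeDiagram s t) (treeDiagram s' t') where
  arcs := harcs
  intervals a b hab := by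
    obtain ⟨u, v, n, rfl, rfl, hl⟩ := exists_leaf_of_isInterval hab
    obtain ⟨x', y', h1, h2⟩ := h u v hl
    exact ⟨x', y', isInterval_of_mem_leaves h1, h2.domain_translate n⟩

/-- The half turn exchanges the two arcs of the base diagram. -/
theorem delta_mem : delta ∈ rearrangementGroup := by
  refine mem_dyadicRearrangements_iff.2 ⟨_, _, isArcDiagram_treeDiagram leaf leaf leaf leaf,
    isArcDiagram_treeDiagram leaf leaf leaf leaf, carries_treeDiagram ?_ fun x y h => ?_⟩
  · have h1 := (delta_mapsLinearly_sub (x := 5 / 6) (y := 7 / 6) (x' := 1 / 3) (y' := 2 / 3)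
      (by norm_num) (by norm_num))
    have h2 := (delta_mapsLinearly_add (x := 1 / 3) (y := 2 / 3) (x' := 5 / 6) (y' := 7 / 6)
      (by norm_num) (by norm_num))
    have e1 := h1.left
    have e2 := h1.right
    have e3 := h2.left
    have e4 := h2.right
    rw [coe_seven_sixths] at e2 e4
    rw [← baseDiagram_eq_treeDiagram, baseDiagram, image_pair, Sym2.map_mk, Sym2.map_mk,
      e1, e2, e3, e4, pair_comm, Sym2.eq_swap (a := ((2 / 3 : ℝ) : UnitAddCircle)),
      Sym2.eq_swap (a := ((5 / 6 : ℝ) : UnitAddCircle))]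
  · norm_num [leaves] at h
    rcases h with (⟨rfl, rfl⟩ | ⟨rfl, rfl⟩ | ⟨rfl, rfl⟩) | ⟨rfl, rfl⟩
    · exact ⟨2 / 3, 5 / 6, by norm_num [leaves],
        delta_mapsLinearly_add (by norm_num) (by norm_num)⟩
    · exact ⟨5 / 6, 7 / 6, by norm_num [leaves],
        delta_mapsLinearly_add (by norm_num) (by norm_num)⟩
    · exact ⟨1 / 6, 1 / 3, by norm_num [leaves],
        delta_mapsLinearly_sub (by norm_num) (by norm_num)⟩
    · exact ⟨1 / 3, 2 / 3, by norm_num [leaves],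
        delta_mapsLinearly_sub (by norm_num) (by norm_num)⟩

/-- Both diagrams consist of three parallel arcs. The arc {5/12, 7/12} goes to {1/3, 2/3}, which
goes to {1/6, 5/6}, which goes to {11/12, 13/12}. -/
theorem alpha_mem : alpha ∈ rearrangementGroup := by
  refine mem_dyadicRearrangements_iff.2 ⟨_, _,
    isArcDiagram_treeDiagram leaf (node leaf leaf leaf) leaf leaf,
    isArcDiagram_treeDiagram leaf leaf leaf (node leaf leaf leaf),
    carries_treeDiagram ?_ fun x y h => ?_⟩
  · have h1 := alpha_mapsLinearly_left (x := 1 / 3) (y := 2 / 3) (x' := 1 / 6) (y' := 5 / 6)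
      (by norm_num) (by norm_num) (by norm_num) (by norm_num) (by norm_num)
    have h2 := alpha_mapsLinearly_right (x := 5 / 6) (y := 7 / 6) (x' := 11 / 12) (y' := 13 / 12)
      (by norm_num) (by norm_num) (by norm_num) (by norm_num) (by norm_num)
    have e2 := h2.right
    rw [coe_seven_sixths] at e2
    have e3 : primaryArc (5 / 6) (7 / 6) =
      s(((11 / 12 : ℝ) : UnitAddCircle), ((13 / 12 : ℝ) : UnitAddCircle)) := by
      rw [primaryArc]; norm_num
    norm_num [treeDiagram, arcs, rootDiagram, image_insert_eq, image_pair]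
    rw [h1.map_primaryArc, primaryArc_root, Sym2.map_mk, h1.left, h1.right, h2.left, e2, e3,
      Sym2.eq_swap (a := ((13 / 12 : ℝ) : UnitAddCircle))]
    ext A
    simp only [mem_insert_iff, mem_singleton_iff]
    tauto
  · norm_num [leaves] at h
    rcases h with (⟨rfl, rfl⟩ | h) | h
    -- The leaf [1/6, 1/3] lies outside [1/3, 4/3], where the lift of α describes it, so its
    -- translate [7/6, 4/3] is used.
    · have h1 := alpha_mapsLinearly_right (x := 7 / 6) (y := 4 / 3) (x' := 13 / 12) (y' := 7 / 6)
        (by norm_num) (by norm_num) (by norm_num) (by norm_num) (by norm_num)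
      refine ⟨13 / 12, 7 / 6, by norm_num [leaves], ?_⟩
      convert h1.domain_translate (-1) using 1 <;> norm_num
    · rcases h with ⟨rfl, rfl⟩ | ⟨rfl, rfl⟩ | ⟨rfl, rfl⟩ | ⟨rfl, rfl⟩
      on_goal 4 =>
        refine ⟨_, _, ?_, alpha_mapsLinearly_right (by norm_num) (by norm_num) (by norm_num)
          rfl rfl⟩
      all_goals try
        refine ⟨_, _, ?_, alpha_mapsLinearly_left (by norm_num) (by norm_num) (by norm_num)
          rfl rfl⟩
      all_goals norm_num [leaves]
    · obtain ⟨rfl, rfl⟩ := h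
      refine ⟨_, _, ?_, alpha_mapsLinearly_right (by norm_num) (by norm_num) (by norm_num)
          rfl rfl⟩
      norm_num [leaves]

/-! ### Leafwise linear maps, and membership of β and γ -/

/-- The homeomorphism `f` maps the leaves of `s` on `[a, b]` linearly onto those of `t` on
`[c, d]`, in order. -/
def CarriesLeaves (f : UnitAddCircle ≃ₜ UnitAddCircle) (s t : TernaryTree) (a b c d : ℝ) : Prop :=
  List.Forall₂ (fun I J : ℝ × ℝ => MapsLinearly f I.1 I.2 J.1 J.2) (s.leaves a b) (t.leaves c d)

theorem CarriesLeaves.exists_leaf {f : UnitAddCircle ≃ₜ UnitAddCircle} {s t : TernaryTree}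
    {a b c d x y : ℝ} (h : CarriesLeaves f s t a b c d) (hx : (x, y) ∈ s.leaves a b) :
    ∃ x' y', (x', y') ∈ t.leaves c d ∧ MapsLinearly f x y x' y' := by
  obtain ⟨i, hi, he⟩ := List.mem_iff_getElem.1 hx
  have h1 := h.get hi (h.length_eq ▸ hi)
  refine ⟨_, _, List.getElem_mem (h.length_eq ▸ hi), ?_⟩
  simpa [he] using h1

/-- The binary operation `(x, y) ↦ node x leaf y` on leaves, bracketed to the right. -/
def rightComb : TernaryTree := node leaf leaf (node leaf leaf leaf)

/-- The binary operation `(x, y) ↦ node x leaf y` on leaves, bracketed to the left. -/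
def leftComb : TernaryTree := node (node leaf leaf leaf) leaf leaf

theorem beta_carriesLeaves :
    CarriesLeaves beta rightComb leftComb (1 / 6) (5 / 6) (1 / 6) (5 / 6) := by
  norm_num [CarriesLeaves, rightComb, leftComb, leaves]
  refine ⟨?_, ?_, ?_, ?_, ?_⟩
  · apply beta_mapsLinearly_first <;> norm_num
  · apply beta_mapsLinearly_first <;> norm_num
  · apply beta_mapsLinearly_second <;> norm_num
  · apply beta_mapsLinearly_third <;> norm_num
  · apply beta_mapsLinearly_third <;> norm_num

theorem gamma_carriesLeaves :
    CarriesLeaves gamma rightComb leftComb (1 / 6) (1 / 3) (1 / 6) (1 / 3) := by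
  norm_num [CarriesLeaves, rightComb, leftComb, leaves]
  refine ⟨?_, ?_, ?_, ?_, ?_⟩
  · apply gamma_mapsLinearly_first <;> norm_num
  · apply gamma_mapsLinearly_first <;> norm_num
  · apply gamma_mapsLinearly_second <;> norm_num
  · apply gamma_mapsLinearly_third <;> norm_num
  · apply gamma_mapsLinearly_third <;> norm_num

theorem CarriesLeaves.append {f : UnitAddCircle ≃ₜ UnitAddCircle} {l m r l' m' r' : TernaryTree}
    {a b c d : ℝ}
    (hl : CarriesLeaves f l l' a (a + (b - a) / 4) c (c + (d - c) / 4))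
    (hm : CarriesLeaves f m m' (a + (b - a) / 4) (a + 3 * (b - a) / 4)
      (c + (d - c) / 4) (c + 3 * (d - c) / 4))
    (hr : CarriesLeaves f r r' (a + 3 * (b - a) / 4) b (c + 3 * (d - c) / 4) d) :
    CarriesLeaves f (node l m r) (node l' m' r') a b c d :=
  List.rel_append hl (List.rel_append hm hr)

theorem MapsLinearly.carriesLeaves {f : UnitAddCircle ≃ₜ UnitAddCircle} {a b c d : ℝ}
    (h : MapsLinearly f a b c d) (t : TernaryTree) : CarriesLeaves f t t a b c d := by
  induction t generalizing a b c d with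
  | leaf => exact .cons h .nil
  | node l m r hl hm hr => exact (hl h.left_quarter).append (hm h.middle_half) (hr h.right_quarter)

theorem carriesLeaves_trans {f g : UnitAddCircle ≃ₜ UnitAddCircle} {L M N : List (ℝ × ℝ)}
    (hf : List.Forall₂ (fun I J : ℝ × ℝ => MapsLinearly f I.1 I.2 J.1 J.2) L M)
    (hg : List.Forall₂ (fun I J : ℝ × ℝ => MapsLinearly g I.1 I.2 J.1 J.2) M N) :
    List.Forall₂ (fun I J : ℝ × ℝ => MapsLinearly (g * f) I.1 I.2 J.1 J.2) L N := by
  induction hf generalizing N with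
  | nil => cases hg; exact .nil
  | cons h _ ih =>
    obtain _ | ⟨h', hg⟩ := hg
    exact .cons (h'.mul h) (ih hg)

theorem CarriesLeaves.mul {f g : UnitAddCircle ≃ₜ UnitAddCircle} {s t u : TernaryTree}
    {a b c d x y : ℝ} (hg : CarriesLeaves g t u c d x y) (hf : CarriesLeaves f s t a b c d) :
    CarriesLeaves (g * f) s u a b x y :=
  carriesLeaves_trans hf hg

theorem CarriesLeaves.inv {f : UnitAddCircle ≃ₜ UnitAddCircle} {s t : TernaryTree}
    {a b c d : ℝ} (h : CarriesLeaves f s t a b c d) : CarriesLeaves f⁻¹ t s c d a b :=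
  .flip (h.imp fun _ _ h => h.inv)

theorem beta_mem : beta ∈ rearrangementGroup := by
  refine mem_dyadicRearrangements_iff.2 ⟨_, _,
    isArcDiagram_treeDiagram leaf leaf (node leaf leaf leaf) leaf,
    isArcDiagram_treeDiagram (node leaf leaf leaf) leaf leaf leaf,
    carries_treeDiagram ?_ fun x y h => ?_⟩
  · have h1 : MapsLinearly beta (1 / 3) (2 / 3) (5 / 24) (7 / 24) := by
      apply beta_mapsLinearly_first <;> norm_num
    have h2 : MapsLinearly beta (17 / 24) (19 / 24) (1 / 3) (2 / 3) := by
      apply beta_mapsLinearly_third <;> norm_num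
    have h3 : MapsLinearly beta (5 / 6) (7 / 6) (5 / 6) (7 / 6) := by
      apply beta_mapsLinearly_fourth <;> norm_num
    have e3 := h3.right
    rw [coe_seven_sixths] at e3
    norm_num [treeDiagram, arcs, rootDiagram, image_insert_eq, image_pair, primaryArc]
    rw [h1.left, h1.right, h2.left, h2.right, h3.left, e3]
    ext A
    simp only [mem_insert_iff, mem_singleton_iff]
    tauto
  · rcases h with h | h
    · obtain ⟨x', y', h1, h2⟩ := beta_carriesLeaves.exists_leaf h
      exact ⟨x', y', .inl h1, h2⟩
    · simp only [leaves, List.mem_singleton, Prod.mk.injEq] at h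
      obtain ⟨rfl, rfl⟩ := h
      exact ⟨_, _, .inr (by simp [leaves]), beta_mapsLinearly_fourth le_rfl (by norm_num) le_rfl⟩

theorem gamma_mem : gamma ∈ rearrangementGroup := by
  refine mem_dyadicRearrangements_iff.2 ⟨_, _,
    isArcDiagram_treeDiagram rightComb leaf leaf leaf,
    isArcDiagram_treeDiagram leftComb leaf leaf leaf,
    carries_treeDiagram ?_ fun x y h => ?_⟩
  · have h1 : MapsLinearly gamma (5 / 24) (7 / 24) (17 / 96) (19 / 96) := by
      apply gamma_mapsLinearly_first <;> norm_num
    have h2 : MapsLinearly gamma (29 / 96) (31 / 96) (5 / 24) (7 / 24) := by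
      apply gamma_mapsLinearly_third <;> norm_num
    have h3 : MapsLinearly gamma (1 / 3) (2 / 3) (1 / 3) (2 / 3) := by
      apply gamma_mapsLinearly_fourth <;> norm_num
    have h4 : MapsLinearly gamma (5 / 6) (7 / 6) (5 / 6) (7 / 6) := by
      apply gamma_mapsLinearly_fourth <;> norm_num
    have e4 := h4.right
    rw [coe_seven_sixths] at e4
    norm_num [treeDiagram, arcs, rootDiagram, image_insert_eq, image_pair, primaryArc, rightComb,
      leftComb]
    rw [h1.left, h1.right, h2.left, h2.right, h3.left, h3.right, h4.left, e4]
    ext A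
    simp only [mem_insert_iff, mem_singleton_iff]
    tauto
  · rcases h with h | h
    · have key : CarriesLeaves gamma (node rightComb leaf leaf) (node leftComb leaf leaf)
          (1 / 6) (5 / 6) (1 / 6) (5 / 6) := by
        refine .append ?_ (.cons ?_ .nil) (.cons ?_ .nil)
        · convert gamma_carriesLeaves using 1 <;> norm_num
        · apply gamma_mapsLinearly_fourth <;> norm_num
        · apply gamma_mapsLinearly_fourth <;> norm_num
      obtain ⟨x', y', h1, h2⟩ := key.exists_leaf h
      exact ⟨x', y', .inl h1, h2⟩
    · simp only [leaves, List.mem_singleton, Prod.mk.injEq] at h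
      obtain ⟨rfl, rfl⟩ := h
      exact ⟨_, _, .inr (by simp [leaves]),
        gamma_mapsLinearly_fourth (by norm_num) (by norm_num) le_rfl⟩

/-! ### The subgroup generated by `α`, `β`, `γ`, `δ` -/

/-- The subgroup generated by `α`, `β`, `γ` and `δ`. -/
noncomputable def generatedSubgroup : Subgroup (UnitAddCircle ≃ₜ UnitAddCircle) :=
  Subgroup.closure {alpha, beta, gamma, delta}

theorem alpha_mem_generated : alpha ∈ generatedSubgroup :=
  Subgroup.subset_closure (by simp)

theorem beta_mem_generated : beta ∈ generatedSubgroup :=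
  Subgroup.subset_closure (by simp)

theorem gamma_mem_generated : gamma ∈ generatedSubgroup :=
  Subgroup.subset_closure (by simp)

theorem delta_mem_generated : delta ∈ generatedSubgroup :=
  Subgroup.subset_closure (by simp)

/-- Some element of the subgroup generated by `α`, `β`, `γ`, `δ` maps `[a, b]` linearly onto
`[c, d]`. -/
def Equivalent (a b c d : ℝ) : Prop :=
  ∃ g ∈ generatedSubgroup, MapsLinearly g a b c d

theorem Equivalent.trans {a b c d x y : ℝ} (h : Equivalent a b c d) (h' : Equivalent c d x y) :
    Equivalent a b x y := by
  obtain ⟨g, hg, h⟩ := h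
  obtain ⟨g', hg', h'⟩ := h'
  exact ⟨g' * g, mul_mem hg' hg, h'.mul h⟩

theorem Equivalent.symm {a b c d : ℝ} (h : Equivalent a b c d) : Equivalent c d a b := by
  obtain ⟨g, hg, h⟩ := h
  exact ⟨g⁻¹, inv_mem hg, h.inv⟩

theorem Equivalent.refl (a b : ℝ) : Equivalent a b a b :=
  ⟨1, one_mem _, fun _ _ => rfl⟩

/-- Intervals equivalent to `[1/6, 5/6]` or to `[1/6, 1/3]`. -/
def IsStandard (a b : ℝ) : Prop :=
  Equivalent a b (1 / 6) (5 / 6) ∨ Equivalent a b (1 / 6) (1 / 3)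

theorem Equivalent.isStandard {a b c d : ℝ} (h : Equivalent a b c d) (h' : IsStandard c d) :
    IsStandard a b :=
  h'.imp h.trans h.trans

theorem isStandard_root : IsStandard (1 / 6) (5 / 6) :=
  .inl (.refl _ _)

theorem isStandard_first : IsStandard (1 / 6) (1 / 3) :=
  .inr (.refl _ _)

theorem isStandard_second : IsStandard (1 / 3) (2 / 3) :=
  .inl ⟨alpha, alpha_mem_generated, by apply alpha_mapsLinearly_left <;> norm_num⟩

theorem isStandard_third : IsStandard (2 / 3) (5 / 6) :=
  .inr ⟨delta, delta_mem_generated, by apply delta_mapsLinearly_sub <;> norm_num⟩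

theorem isStandard_fourth : IsStandard (5 / 6) (7 / 6) :=
  Equivalent.isStandard
    ⟨delta, delta_mem_generated, by apply delta_mapsLinearly_sub <;> norm_num⟩ isStandard_second

/-- `beta⁻¹` magnifies [1/6, 7/24] by the factor 4 onto [1/6, 2/3], which undoes a subdivision near
1/6. -/
theorem equivalent_beta {a b c d : ℝ} (hc : 1 / 6 ≤ c) (hcd : c ≤ d) (hd : d ≤ 2 / 3)
    (ha : a = c / 4 + 1 / 8) (hb : b = d / 4 + 1 / 8) : Equivalent a b c d :=
  Equivalent.symm ⟨beta, beta_mem_generated, beta_mapsLinearly_first hc hcd hd ha hb⟩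

namespace IsStandard

variable {a b : ℝ}

/-- This and the next two lemmas show that subdivision stays within the two classes. It suffices to
split the two model intervals: the pieces of [1/6, 5/6] are known to be standard, and those of [1/6,
1/3] are moved by `beta⁻¹` to larger or known ones. -/
theorem left_quarter (h : IsStandard a b) : IsStandard a (a + (b - a) / 4) := by
  rcases h with ⟨g, hg, h⟩ | ⟨g, hg, h⟩
  · refine Equivalent.isStandard ⟨g, hg, h.left_quarter⟩ ?_
    convert isStandard_first using 1; norm_num
  · refine Equivalent.isStandard ⟨g, hg, h.left_quarter⟩
      (Equivalent.isStandard (equivalent_beta (c := 1 / 6) (d := 1 / 3) ?_ ?_ ?_ ?_ ?_)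
        isStandard_first) <;> norm_num

theorem middle_half (h : IsStandard a b) :
    IsStandard (a + (b - a) / 4) (a + 3 * (b - a) / 4) := by
  rcases h with ⟨g, hg, h⟩ | ⟨g, hg, h⟩
  · refine Equivalent.isStandard ⟨g, hg, h.middle_half⟩ ?_
    convert isStandard_second using 1 <;> norm_num
  · refine Equivalent.isStandard ⟨g, hg, h.middle_half⟩
      (Equivalent.isStandard (equivalent_beta (c := 1 / 3) (d := 2 / 3) ?_ ?_ ?_ ?_ ?_)
        isStandard_second) <;> norm_num

theorem right_quarter (h : IsStandard a b) : IsStandard (a + 3 * (b - a) / 4) b := by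
  rcases h with ⟨g, hg, h⟩ | ⟨g, hg, h⟩
  · refine Equivalent.isStandard ⟨g, hg, h.right_quarter⟩ ?_
    convert isStandard_third using 1; norm_num
  -- The last quarter of [1/6, 1/3] is not in the magnified range of `beta⁻¹`: it is translated to
  -- [2/3, 17/24], turned by `delta` to start at 1/6, and only then magnified.
  · have h1 : Equivalent (7 / 24) (1 / 3) (2 / 3) (17 / 24) := Equivalent.symm
      ⟨beta, beta_mem_generated, by apply beta_mapsLinearly_second <;> norm_num⟩
    have h2 : Equivalent (2 / 3) (17 / 24) (1 / 6) (5 / 24) :=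
      ⟨delta, delta_mem_generated, by apply delta_mapsLinearly_sub <;> norm_num⟩
    have h3 : Equivalent (1 / 6) (5 / 24) (1 / 6) (1 / 3) := by
      apply equivalent_beta <;> norm_num
    refine Equivalent.isStandard ⟨g, hg, h.right_quarter⟩ ?_
    convert (h1.trans h2).isStandard (h3.isStandard isStandard_first) using 1; norm_num

/-- The endpoints of the primary arc of a standard interval can be moved to `1/3` and `2/3`. -/
theorem exists_move (h : IsStandard a b) : ∃ g ∈ generatedSubgroup,
    g ((a + (b - a) / 4 : ℝ) : UnitAddCircle) = ((1 / 3 : ℝ) : UnitAddCircle) ∧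
      g ((a + 3 * (b - a) / 4 : ℝ) : UnitAddCircle) = ((2 / 3 : ℝ) : UnitAddCircle) := by
  have key : Equivalent (a + (b - a) / 4) (a + 3 * (b - a) / 4) (1 / 3) (2 / 3) := by
    rcases h with ⟨g, hg, h⟩ | ⟨g, hg, h⟩
    · refine ⟨g, hg, ?_⟩
      convert h.middle_half using 1 <;> norm_num
    · refine Equivalent.trans ⟨g, hg, h.middle_half⟩ ?_
      apply equivalent_beta <;> norm_num
  obtain ⟨g, hg, h⟩ := key
  exact ⟨g, hg, h.left, h.right⟩

/-- Each arc of the tree is the primary arc of an interval that is again standard. The orientation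
is left open, since an arc of the tree is an unordered pair. -/
theorem exists_move_of_mem_arcs {t : TernaryTree} {u v : UnitAddCircle} (h : IsStandard a b)
    (ht : s(u, v) ∈ t.arcs a b) : ∃ g ∈ generatedSubgroup,
      s(g u, g v) = s(((1 / 3 : ℝ) : UnitAddCircle), ((2 / 3 : ℝ) : UnitAddCircle)) := by
  induction t generalizing a b with
  | leaf => exact ht.elim
  | node l m r hl hm hr =>
    rcases ht with ht | (ht | ht) | ht
    · obtain ⟨g, hg, h1, h2⟩ := h.exists_move
      refine ⟨g, hg, ?_⟩
      rw [← Sym2.map_mk, ht, primaryArc, Sym2.map_mk, h1, h2]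
    · exact hl h.left_quarter ht
    · exact hm h.middle_half ht
    · exact hr h.right_quarter ht

end IsStandard

/-- The subgroup generated by `α`, `β`, `γ`, `δ` acts transitively on oriented arcs. -/
theorem exists_move_to_root {D : Set Arc} (hD : IsArcDiagram D) {u v : UnitAddCircle}
    (h : s(u, v) ∈ D) : ∃ g ∈ generatedSubgroup,
      g u = ((1 / 6 : ℝ) : UnitAddCircle) ∧ g v = ((5 / 6 : ℝ) : UnitAddCircle) := by
  have hα : MapsLinearly alpha (1 / 3) (2 / 3) (1 / 6) (5 / 6) := by
    apply alpha_mapsLinearly_left <;> norm_num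
  have hδ : MapsLinearly delta (2 / 3) (4 / 3) (1 / 6) (5 / 6) := by
    apply delta_mapsLinearly_sub <;> norm_num
  have hδ' : MapsLinearly delta (5 / 6) (7 / 6) (1 / 3) (2 / 3) := by
    apply delta_mapsLinearly_sub <;> norm_num
  have e : ((4 / 3 : ℝ) : UnitAddCircle) = ((1 / 3 : ℝ) : UnitAddCircle) :=
    coe_eq_coe_iff.2 ⟨1, by norm_num⟩
  have hδ2 := hδ.right
  have hδ3 := hδ'.right
  rw [e] at hδ2
  rw [coe_seven_sixths] at hδ3
  have key : s(u, v) ∈ rootDiagram ∨ ∃ g ∈ generatedSubgroup,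
      s(g u, g v) = s(((1 / 3 : ℝ) : UnitAddCircle), ((2 / 3 : ℝ) : UnitAddCircle)) := by
    obtain ⟨l, m, r, t, rfl⟩ := hD.exists_tree
    rcases h with (h | h) | h
    · exact .inl h
    · exact .inr (isStandard_root.exists_move_of_mem_arcs h)
    · exact .inr (isStandard_fourth.exists_move_of_mem_arcs h)
  -- The orientation is settled here: `alpha * delta` reverses the root arc, while `alpha` and
  -- `delta` take {1/3, 2/3} to the root arc with opposite orientations.
  rcases key with h | ⟨g, hg, h⟩
  · rcases Sym2.eq_iff.1 h with ⟨rfl, rfl⟩ | ⟨rfl, rfl⟩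
    · exact ⟨1, one_mem _, rfl, rfl⟩
    · refine ⟨alpha * delta, mul_mem alpha_mem_generated delta_mem_generated, ?_, ?_⟩
      · rw [Homeomorph.mul_apply, hδ'.left, hα.left]
      · rw [Homeomorph.mul_apply, hδ3, hα.right]
  · rcases Sym2.eq_iff.1 h with ⟨h1, h2⟩ | ⟨h1, h2⟩
    · refine ⟨alpha * g, mul_mem alpha_mem_generated hg, ?_, ?_⟩
      · rw [Homeomorph.mul_apply, h1, hα.left]
      · rw [Homeomorph.mul_apply, h2, hα.right]
    · refine ⟨delta * g, mul_mem delta_mem_generated hg, ?_, ?_⟩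
      · rw [Homeomorph.mul_apply, h1, hδ.left]
      · rw [Homeomorph.mul_apply, h2, hδ2]

/-! ### Reassociation -/

/-- `f` is the identity on the complement `[b, a + 1]` of the interval `[a, b]`. -/
def FixesComplement (f : UnitAddCircle ≃ₜ UnitAddCircle) (a b : ℝ) : Prop :=
  ∀ x ∈ Icc b (a + 1), f (x : UnitAddCircle) = x

namespace FixesComplement

variable {f g : UnitAddCircle ≃ₜ UnitAddCircle} {a b c d x : ℝ}

theorem mono (h : FixesComplement f a b) (hca : c ≤ a) (hbd : b ≤ d) : FixesComplement f c d :=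
  fun x hx => h x ⟨by linarith [hx.1], by linarith [hx.2]⟩

theorem apply_sub_one (h : FixesComplement f a b) (hx : x ∈ Icc (b - 1) a) :
    f (x : UnitAddCircle) = x := by
  have e : ((x + 1 : ℝ) : UnitAddCircle) = x := by simp
  rw [← e]
  exact h _ ⟨by linarith [hx.1], by linarith [hx.2]⟩

theorem mul (hg : FixesComplement g a b) (hf : FixesComplement f a b) :
    FixesComplement (g * f) a b := fun x hx => by
  rw [Homeomorph.mul_apply, hf x hx, hg x hx]

theorem inv (hf : FixesComplement f a b) : FixesComplement f⁻¹ a b := fun x hx => by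
  conv_lhs => rw [← hf x hx]
  exact f.symm_apply_apply _

/-- Points of the open interval `(c, d)` are images of points of `(a, b)`, so by injectivity `f`
sends the complement of `[a, b]` to points that `g` fixes. -/
theorem conj (hg : FixesComplement g c d) (hf : MapsLinearly f a b c d) (hab : a < b)
    (hcd : c < d) (hd : d ≤ c + 1) : FixesComplement (f⁻¹ * g * f) a b := fun x hx => by
  have key : g (f x) = f x := by
    have hmem : f x ∈ ((↑) : ℝ → UnitAddCircle) '' Ico c (c + 1) := by
      rw [AddCircle.coe_image_Ico_eq]; trivial
    obtain ⟨y, hy, hyx⟩ := hmem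
    rw [← hyx]
    rcases hy.1.eq_or_lt with rfl | hcy
    -- The point `c` is fixed because `c + 1` lies in `[d, c + 1]`.
    · exact hg.apply_sub_one ⟨by linarith, le_rfl⟩
    rcases le_or_gt d y with hdy | hyd
    · exact hg y ⟨hdy, hy.2.le⟩
    · obtain ⟨z, hz, hzy⟩ := hf.exists_eq hcd ⟨hcy, hyd⟩ hab
      have := eq_of_coe_eq (f.injective (hzy.trans hyx)) (by linarith [hz.2, hx.1])
        (by linarith [hz.1, hx.2])
      linarith [hz.2, hx.1]
  rw [Homeomorph.mul_apply, Homeomorph.mul_apply, key]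
  exact f.symm_apply_apply _

theorem carriesLeaves_right (h : FixesComplement f a b) (t : TernaryTree) (hbc : b ≤ c)
    (hcd : c ≤ d) (hd : d ≤ a + 1) : CarriesLeaves f t t c d c d :=
  (MapsLinearly.of_fixed (fun x hx => h x ⟨by linarith [hx.1], by linarith [hx.2]⟩)
    hcd).carriesLeaves t

theorem carriesLeaves_left (h : FixesComplement f a b) (t : TernaryTree) (hbc : b ≤ c + 1)
    (hcd : c ≤ d) (hd : d ≤ a) : CarriesLeaves f t t c d c d :=
  (MapsLinearly.of_fixed (fun x hx => h.apply_sub_one ⟨by linarith [hx.1], by linarith [hx.2]⟩)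
    hcd).carriesLeaves t

end FixesComplement

theorem beta_fixesComplement : FixesComplement beta (1 / 6) (5 / 6) := fun x hx => by
  have := hx.2
  exact (beta_mapsLinearly_fourth (x := x) (y := x) hx.1 le_rfl (by linarith)).left

theorem gamma_fixesComplement : FixesComplement gamma (1 / 6) (1 / 3) := fun x hx => by
  have := hx.2
  exact (gamma_mapsLinearly_fourth (x := x) (y := x) hx.1 le_rfl (by linarith)).left

/-- A conjugate of `beta` or of `gamma` is taken, according to the class of the interval. -/
theorem IsStandard.exists_rotation {a b : ℝ} (h : IsStandard a b) (hab : a < b) :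
    ∃ g ∈ generatedSubgroup, FixesComplement g a b ∧
      CarriesLeaves g rightComb leftComb a b a b := by
  rcases h with ⟨f, hf, h⟩ | ⟨f, hf, h⟩
  · exact ⟨f⁻¹ * beta * f, mul_mem (mul_mem (inv_mem hf) beta_mem_generated) hf,
      beta_fixesComplement.conj h hab (by norm_num) (by norm_num),
      ((h.carriesLeaves _).inv.mul beta_carriesLeaves).mul (h.carriesLeaves _)⟩
  · exact ⟨f⁻¹ * gamma * f, mul_mem (mul_mem (inv_mem hf) gamma_mem_generated) hf,
      gamma_fixesComplement.conj h hab (by norm_num) (by norm_num),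
      ((h.carriesLeaves _).inv.mul gamma_carriesLeaves).mul (h.carriesLeaves _)⟩

/-- The equivalence relation on trees generated by associativity of `(x, y) ↦ node x m y`. -/
inductive Assoc : TernaryTree → TernaryTree → Prop
  | refl (t : TernaryTree) : Assoc t t
  | symm {s t : TernaryTree} (h : Assoc s t) : Assoc t s
  | trans {s t u : TernaryTree} (h : Assoc s t) (h' : Assoc t u) : Assoc s u
  | left {l l' : TernaryTree} (m r : TernaryTree) (h : Assoc l l') :
      Assoc (node l m r) (node l' m r)
  | middle {m m' : TernaryTree} (l r : TernaryTree) (h : Assoc m m') :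
      Assoc (node l m r) (node l m' r)
  | right {r r' : TernaryTree} (l m : TernaryTree) (h : Assoc r r') :
      Assoc (node l m r) (node l m r')
  | rotate (x m y n z : TernaryTree) :
      Assoc (node x m (node y n z)) (node (node x m y) n z)

/-- The five leaves of the combs are mapped linearly, so each carries along an arbitrary subtree. -/
theorem CarriesLeaves.rotate {g : UnitAddCircle ≃ₜ UnitAddCircle} {a b c d : ℝ}
    (h : CarriesLeaves g rightComb leftComb a b c d) (x m y n z : TernaryTree) :
    CarriesLeaves g (node x m (node y n z)) (node (node x m y) n z) a b c d := by
  simp only [CarriesLeaves, rightComb, leftComb, leaves, List.cons_append, List.nil_append,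
    List.forall₂_cons, List.Forall₂.nil, and_true] at h
  obtain ⟨h1, h2, h3, h4, h5⟩ := h
  have := List.rel_append (h1.carriesLeaves x) (List.rel_append (h2.carriesLeaves m)
    (List.rel_append (h3.carriesLeaves y) (List.rel_append (h4.carriesLeaves n)
      (h5.carriesLeaves z))))
  simpa only [CarriesLeaves, leaves, List.append_assoc] using this

/-- The support condition drives the induction: a change inside one child is made by an element that
fixes the intervals of the other two children pointwise. Each child interval is again standard. -/
theorem Assoc.exists_carriesLeaves {s t : TernaryTree} (h : Assoc s t) {a b : ℝ} (hab : a < b)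
    (hb : b ≤ a + 1) (hst : IsStandard a b) :
    ∃ g ∈ generatedSubgroup, FixesComplement g a b ∧ CarriesLeaves g s t a b a b := by
  induction h generalizing a b with
  | refl t =>
    exact ⟨1, one_mem _, fun _ _ => rfl, MapsLinearly.carriesLeaves (fun _ _ => rfl) t⟩
  | symm h ih =>
    obtain ⟨g, hg, h1, h2⟩ := ih hab hb hst
    exact ⟨g⁻¹, inv_mem hg, h1.inv, h2.inv⟩
  | trans h h' ih ih' =>
    obtain ⟨g, hg, h1, h2⟩ := ih hab hb hst
    obtain ⟨g', hg', h1', h2'⟩ := ih' hab hb hst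
    exact ⟨g' * g, mul_mem hg' hg, h1'.mul h1, h2'.mul h2⟩
  | left m r h ih =>
    obtain ⟨g, hg, h1, h2⟩ := ih (by linarith) (by linarith) hst.left_quarter
    exact ⟨g, hg, h1.mono le_rfl (by linarith),
      h2.append (h1.carriesLeaves_right _ (by linarith) (by linarith) (by linarith))
        (h1.carriesLeaves_right _ (by linarith) (by linarith) (by linarith))⟩
  | middle l r h ih =>
    obtain ⟨g, hg, h1, h2⟩ := ih (by linarith) (by linarith) hst.middle_half
    exact ⟨g, hg, h1.mono (by linarith) (by linarith),
      (h1.carriesLeaves_left _ (by linarith) (by linarith) (by linarith)).append h2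
        (h1.carriesLeaves_right _ (by linarith) (by linarith) (by linarith))⟩
  | right l m h ih =>
    obtain ⟨g, hg, h1, h2⟩ := ih (by linarith) (by linarith) hst.right_quarter
    exact ⟨g, hg, h1.mono (by linarith) (by linarith),
      (h1.carriesLeaves_left _ (by linarith) (by linarith) (by linarith)).append
        (h1.carriesLeaves_left _ (by linarith) (by linarith) (by linarith)) h2⟩
  | rotate x m y n z =>
    obtain ⟨g, hg, h1, h2⟩ := hst.exists_rotation hab
    exact ⟨g, hg, h1, h2.rotate x m y n z⟩

/-! ### Words of parentheses -/

namespace TernaryTree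

/-- The word of opening (`true`) and closing (`false`) parentheses formed by the endpoints of the
arcs of a tree, read from left to right. -/
def word : TernaryTree → List Bool
  | leaf => []
  | node l m r => l.word ++ true :: (m.word ++ false :: r.word)

/-- The endpoints of the arcs of `t` on `[a, b]` from left to right, each paired with the opposite
endpoint of its arc. -/
noncomputable def ends : TernaryTree → ℝ → ℝ → List (ℝ × ℝ)
  | leaf, _, _ => []
  | node l m r, a, b =>
    l.ends a (a + (b - a) / 4) ++ (a + (b - a) / 4, a + 3 * (b - a) / 4) ::
      (m.ends (a + (b - a) / 4) (a + 3 * (b - a) / 4) ++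
        (a + 3 * (b - a) / 4, a + (b - a) / 4) :: r.ends (a + 3 * (b - a) / 4) b)

/-- An endpoint opens its arc exactly when it lies to the left of its partner. -/
theorem word_eq_map_ends (t : TernaryTree) {a b : ℝ} (hab : a < b) :
    t.word = (t.ends a b).map fun e => decide (e.1 < e.2) := by
  induction t generalizing a b with
  | leaf => rfl
  | node l m r hl hm hr =>
    have h1 : a + (b - a) / 4 < a + 3 * (b - a) / 4 := by linarith
    simp only [word, ends, List.map_append, List.map_cons,
      ← hl (show a < a + (b - a) / 4 by linarith),
      ← hm h1, ← hr (show a + 3 * (b - a) / 4 < b by linarith), h1, h1.le.not_gt,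
      decide_true, decide_false]

/-- The arc endpoints are the left endpoints of all leaves but the first; this turns a matching of
leaves into a matching of arc endpoints. -/
theorem map_fst_leaves (t : TernaryTree) (a b : ℝ) :
    (t.leaves a b).map Prod.fst = a :: (t.ends a b).map Prod.fst := by
  induction t generalizing a b with
  | leaf => rfl
  | node l m r hl hm hr => simp [leaves, ends, hl, hm, hr]

theorem swap_mem_ends {t : TernaryTree} {a b x y : ℝ} (h : (x, y) ∈ t.ends a b) :
    (y, x) ∈ t.ends a b := by
  induction t generalizing a b with
  | leaf => simp [ends] at h
  | node l m r hl hm hr =>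
    simp only [ends, List.mem_append, List.mem_cons, Prod.mk.injEq] at h ⊢
    rcases h with h | h | h | h | h
    · exact .inl (hl h)
    · exact .inr (.inr (.inr (.inl h.symm)))
    · exact .inr (.inr (.inl (hm h)))
    · exact .inr (.inl h.symm)
    · exact .inr (.inr (.inr (.inr (hr h))))

theorem mem_arcs_of_mem_ends {t : TernaryTree} {a b x y : ℝ} (h : (x, y) ∈ t.ends a b) :
    s((x : UnitAddCircle), (y : UnitAddCircle)) ∈ t.arcs a b := by
  induction t generalizing a b with
  | leaf => simp [ends] at h
  | node l m r hl hm hr =>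
    simp only [ends, List.mem_append, List.mem_cons, Prod.mk.injEq] at h
    rcases h with h | ⟨rfl, rfl⟩ | h | ⟨rfl, rfl⟩ | h
    · exact .inr (.inl (.inl (hl h)))
    · exact .inl rfl
    · exact .inr (.inl (.inr (hm h)))
    · exact .inl Sym2.eq_swap
    · exact .inr (.inr (hr h))

end TernaryTree

theorem Assoc.word_eq {s t : TernaryTree} (h : Assoc s t) : s.word = t.word := by
  induction h with
  | refl => rfl
  | symm _ ih => exact ih.symm
  | trans _ _ ih ih' => exact ih.trans ih'
  | left _ _ _ ih | middle _ _ _ ih | right _ _ _ ih => simp only [word, ih]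
  | rotate => simp [word]

/-- Repeated rotation to the right brings the first opening parenthesis of the word to the root. -/
theorem exists_assoc_leaf_node (l m r : TernaryTree) :
    ∃ m' r', Assoc (node l m r) (node leaf m' r') := by
  induction l generalizing m r with
  | leaf => exact ⟨m, r, .refl _⟩
  | node x k y hx _ _ =>
    obtain ⟨m', r', h⟩ := hx k (node y m r)
    exact ⟨m', r', (Assoc.rotate x k y m r).symm.trans h⟩

/-- This is unique parsing. Words of trees are balanced, so the unmatched `false` marks where the
word stops. In the normal form `node leaf m r` the word is `( m ) r`; the induction treats `m`,
closed by its own parenthesis, and then `r`. -/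
theorem assoc_of_word_append_eq (n : ℕ) : ∀ (s t : TernaryTree) (x y : List Bool),
    s.word.length ≤ n → s.word ++ false :: x = t.word ++ false :: y → Assoc s t ∧ x = y := by
  induction n using Nat.strong_induction_on with
  | _ n ih =>
    intro s t x y hn h
    obtain _ | ⟨l, m, r⟩ := s
    · obtain _ | ⟨l', m', r'⟩ := t
      · exact ⟨.refl _, by simpa [word] using h⟩
      -- One side now begins with a closing parenthesis and the other with an opening one.
      · obtain ⟨m₁, r₁, h₁⟩ := exists_assoc_leaf_node l' m' r'
        rw [h₁.word_eq] at h
        simp [word] at h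
    · obtain ⟨m₁, r₁, h₁⟩ := exists_assoc_leaf_node l m r
      obtain _ | ⟨l', m', r'⟩ := t
      · rw [h₁.word_eq] at h
        simp [word] at h
      · obtain ⟨m₂, r₂, h₂⟩ := exists_assoc_leaf_node l' m' r'
        rw [h₁.word_eq] at h hn
        rw [h₂.word_eq] at h
        simp only [word, List.nil_append, List.cons_append, List.append_assoc, List.cons.injEq,
          true_and] at h
        simp only [word, List.nil_append, List.length_cons, List.length_append] at hn
        obtain ⟨hm, h⟩ := ih m₁.word.length (by omega) _ _ _ _ le_rfl h
        obtain ⟨hr, h⟩ := ih r₁.word.length (by omega) _ _ _ _ le_rfl h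
        exact ⟨(h₁.trans ((Assoc.middle _ _ hm).trans (Assoc.right _ _ hr))).trans h₂.symm, h⟩

theorem assoc_of_word_eq {s t : TernaryTree} (h : s.word = t.word) : Assoc s t :=
  (assoc_of_word_append_eq _ s t [] [] le_rfl (by rw [h])).1

/-! ### Matching the leaves of two trees -/

/-- The consecutive intervals of `L` subdivide `[a, b]`. -/
inductive Subdivides : List (ℝ × ℝ) → ℝ → ℝ → Prop
  | nil (a : ℝ) : Subdivides [] a a
  | cons {L : List (ℝ × ℝ)} {a x b : ℝ} (hax : a < x) (hL : Subdivides L x b) :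
      Subdivides ((a, x) :: L) a b

theorem Subdivides.le {L : List (ℝ × ℝ)} {a b : ℝ} (h : Subdivides L a b) : a ≤ b := by
  induction h with
  | nil => exact le_rfl
  | cons hax _ ih => exact hax.le.trans ih

theorem Subdivides.append {L M : List (ℝ × ℝ)} {a x b : ℝ} (h : Subdivides L a x)
    (h' : Subdivides M x b) : Subdivides (L ++ M) a b := by
  induction h with
  | nil => exact h'
  | cons hax _ ih => exact .cons hax (ih h')

theorem Subdivides.pairwise {L : List (ℝ × ℝ)} {a b : ℝ} (h : Subdivides L a b) :
    (L.map Prod.fst).Pairwise (· < ·) ∧ ∀ x ∈ L.map Prod.fst, a ≤ x ∧ x < b := by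
  induction h with
  | nil => simp
  | cons hax hL ih =>
    simp only [List.map_cons, List.pairwise_cons, List.mem_cons]
    refine ⟨⟨fun y hy => hax.trans_le (ih.2 y hy).1, ih.1⟩, ?_⟩
    rintro y (rfl | hy)
    · exact ⟨le_rfl, hax.trans_le hL.le⟩
    · exact ⟨hax.le.trans (ih.2 y hy).1, (ih.2 y hy).2⟩

theorem TernaryTree.subdivides_leaves (t : TernaryTree) {a b : ℝ} (hab : a < b) :
    Subdivides (t.leaves a b) a b := by
  induction t generalizing a b with
  | leaf => exact .cons hab (.nil b)
  | node l m r hl hm hr =>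
    exact (hl (by linarith)).append ((hm (by linarith)).append (hr (by linarith)))

/-- Both lists are traversed together: the image of the right endpoint of one interval is the start
of the next. The lengths `b - a` and `d - c` are below one, so neither list can end before the other
by wrapping around the circle. -/
theorem Carries.forall₂_mapsLinearly {f : UnitAddCircle ≃ₜ UnitAddCircle} {D R : Set Arc}
    (hf : Carries f D R) {L M : List (ℝ × ℝ)} {a b c d : ℝ} (hL : Subdivides L a b)
    (hM : Subdivides M c d) (hLD : ∀ I ∈ L, IsInterval D I.1 I.2)
    (hMR : ∀ I ∈ M, IsInterval R I.1 I.2) (hb : b < a + 1) (hd : d < c + 1)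
    (hac : f (a : UnitAddCircle) = c) (hbd : f (b : UnitAddCircle) = d) :
    List.Forall₂ (fun I J : ℝ × ℝ => MapsLinearly f I.1 I.2 J.1 J.2) L M := by
  induction hL generalizing M c with
  | nil a =>
    have hcd := hM.le
    have := eq_of_coe_eq (hac.symm.trans hbd) (by linarith) hd
    cases hM with
    | nil => exact .nil
    | cons hcx hM => have := hM.le; linarith
  | cons hax hL ih =>
    have hxb := hL.le
    cases hM with
    | nil =>
      have := eq_of_coe_eq (f.injective (hac.trans hbd.symm)) (by linarith) hb
      linarith
    | cons hcy hM =>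
      have h := hf.mapsLinearly (hLD _ List.mem_cons_self) (hMR _ List.mem_cons_self) hac
      exact .cons h (ih hM (fun I hI => hLD I (by simp [hI])) (fun I hI => hMR I (by simp [hI]))
        (by linarith) (by linarith) h.right hbd)

/-- Every point is an endpoint of at most one arc of `D`. -/
def HasUniquePartners (D : Set Arc) : Prop :=
  ∀ x y z : UnitAddCircle, s(x, y) ∈ D → s(x, z) ∈ D → y = z

/-- The new endpoints are interior to an interval, so they are not endpoints of old arcs. -/
theorem HasUniquePartners.insert {D : Set Arc} (hD : HasUniquePartners D) {a b : ℝ}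
    (h : IsInterval D a b) : HasUniquePartners (insert (primaryArc a b) D) := by
  have key : ∀ x y z : UnitAddCircle, s(x, y) = primaryArc a b → s(x, z) ∉ D := by
    intro x y z hxy hxz
    have hx : x ∈ vertices D := ⟨_, hxz, Sym2.mem_mk_left x z⟩
    have : x ∈ primaryArc a b := hxy ▸ Sym2.mem_mk_left x y
    rcases Sym2.mem_iff.1 this with rfl | rfl
    · exact h.notMem_quarter hx
    · exact h.notMem_three_quarter hx
  rintro x y z (hy | hy) (hz | hz)
  · exact Sym2.congr_right.1 (hy.trans hz.symm)
  · exact absurd hz (key x y z hy)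
  · exact absurd hy (key x z y hz)
  · exact hD x y z hy hz

theorem IsArcDiagram.hasUniquePartners {D : Set Arc} (hD : IsArcDiagram D) :
    HasUniquePartners D := by
  induction hD with
  | base =>
    rw [baseDiagram_eq]
    exact HasUniquePartners.insert (fun x y z hy hz => Sym2.congr_right.1 (hy.trans hz.symm))
      isInterval_rootDiagram_left
  | expand _ hab ih => exact ih.insert hab

/-- The map sends the i-th arc endpoint to the i-th one and respects arcs, so partners occupy the
same positions in both lists. A parenthesis opens exactly when its partner has the larger index. -/
theorem Carries.word_eq {f : UnitAddCircle ≃ₜ UnitAddCircle} {D R : Set Arc} (hf : Carries f D R)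
    (hR : HasUniquePartners R) {s t : TernaryTree} {a b c d : ℝ} (hab : a < b) (hcd : c < d)
    (hd : d ≤ c + 1) (hs : s.arcs a b ⊆ D) (ht : t.arcs c d ⊆ R)
    (h : CarriesLeaves f s t a b c d) : s.word = t.word := by
  obtain ⟨hp, -⟩ := (s.subdivides_leaves hab).pairwise
  obtain ⟨hp', hb'⟩ := (t.subdivides_leaves hcd).pairwise
  rw [map_fst_leaves, List.pairwise_cons] at hp hp'
  rw [map_fst_leaves] at hb'
  have h1 : List.Forall₂ (fun x y : ℝ => f (x : UnitAddCircle) = y)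
      ((s.leaves a b).map Prod.fst) ((t.leaves c d).map Prod.fst) := by
    rw [List.forall₂_map_left_iff, List.forall₂_map_right_iff]
    exact h.imp fun _ _ h => h.left
  rw [map_fst_leaves, map_fst_leaves, List.forall₂_cons, List.forall₂_map_left_iff,
    List.forall₂_map_right_iff] at h1
  have h2 := h1.2
  have hlen := h2.length_eq
  rw [s.word_eq_map_ends hab, t.word_eq_map_ends hcd]
  refine List.ext_getElem (by simp [hlen]) fun i hi hi' => ?_
  rw [List.length_map] at hi hi'
  rw [List.getElem_map, List.getElem_map, decide_eq_decide]
  have mem1 : ((s.ends a b)[i].1, (s.ends a b)[i].2) ∈ s.ends a b := List.getElem_mem hi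
  have mem2 : ((t.ends c d)[i].1, (t.ends c d)[i].2) ∈ t.ends c d := List.getElem_mem hi'
  -- The index `j` is the position of the partner of the endpoint number `i`.
  obtain ⟨j, hj, hje⟩ := List.mem_iff_getElem.1 (swap_mem_ends mem1)
  have hj' := hlen ▸ hj
  have fi : f ((s.ends a b)[i].1 : UnitAddCircle) = ((t.ends c d)[i].1 : UnitAddCircle) :=
    h2.get hi hi'
  have fj : f ((s.ends a b)[j].1 : UnitAddCircle) = ((t.ends c d)[j].1 : UnitAddCircle) :=
    h2.get hj hj'
  have e1 : (s.ends a b)[j].1 = (s.ends a b)[i].2 := by rw [hje]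
  have arc1 := hf.map_mem_iff.2 (hs (mem_arcs_of_mem_ends mem1))
  rw [← e1, fi, fj] at arc1
  have bound : ∀ e ∈ t.ends c d, c ≤ e.1 ∧ e.1 < d := fun e he =>
    hb' _ (List.mem_cons_of_mem _ (List.mem_map_of_mem he))
  -- The image arc and the arc of `t` at the endpoint number `i` both belong to `R`, so their other
  -- ends agree on the circle, and in `[c, d)` also as real numbers.
  have e2 : (t.ends c d)[j].1 = (t.ends c d)[i].2 := by
    have b1 := bound _ (List.getElem_mem hj')
    have b2 := bound _ (swap_mem_ends mem2)
    exact eq_of_coe_eq (hR _ _ _ arc1 (ht (mem_arcs_of_mem_ends mem2))) (by linarith)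
      (by linarith)
  have g1 := hp.2.sortedLT.getElem_lt_getElem_iff (hi := by simpa) (hj := by simpa) (i := i) (j := j)
  have g2 := hp'.2.sortedLT.getElem_lt_getElem_iff (hi := by simpa) (hj := by simpa)
    (i := i) (j := j)
  rw [List.getElem_map, List.getElem_map] at g1 g2
  rw [← e1, ← e2, g1, g2]

theorem CarriesLeaves.eq_self {f : UnitAddCircle ≃ₜ UnitAddCircle} {t : TernaryTree} {a b x : ℝ}
    (h : CarriesLeaves f t t a b a b) (hab : a < b) (hx : x ∈ Icc a b) :
    f (x : UnitAddCircle) = x := by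
  obtain ⟨I, hI, hxI⟩ := t.exists_leaf_mem hx
  exact (List.forall₂_same.1 h I hI).eq_self (bounds_of_mem_leaves hab hI).2.1 hxI

/-! ### Generation -/

theorem generatedSubgroup_le : generatedSubgroup ≤ rearrangementGroup := by
  rw [generatedSubgroup, Subgroup.closure_le]
  rintro f (rfl | rfl | rfl | rfl)
  exacts [alpha_mem, beta_mem, gamma_mem, delta_mem]

/-- With the root arc fixed, each side is mapped to itself, and the generators rebracket the range
tree on each side back into the domain tree. -/
theorem mem_generated_of_fixes_root {f : UnitAddCircle ≃ₜ UnitAddCircle}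
    (hf : f ∈ rearrangementGroup)
    (h1 : f ((1 / 6 : ℝ) : UnitAddCircle) = ((1 / 6 : ℝ) : UnitAddCircle))
    (h5 : f ((5 / 6 : ℝ) : UnitAddCircle) = ((5 / 6 : ℝ) : UnitAddCircle)) :
    f ∈ generatedSubgroup := by
  obtain ⟨D, R, hD, hR, hf⟩ := mem_dyadicRearrangements_iff.1 hf
  obtain ⟨l, m, r, t, rfl⟩ := hD.exists_tree
  obtain ⟨l', m', r', t', rfl⟩ := hR.exists_tree
  set s := node l m r
  set s' := node l' m' r'
  have hs : CarriesLeaves f s s' (1 / 6) (5 / 6) (1 / 6) (5 / 6) :=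
    hf.forall₂_mapsLinearly (subdivides_leaves _ (by norm_num)) (subdivides_leaves _ (by norm_num))
      (fun I hI => isInterval_of_mem_leaves (.inl hI))
      (fun I hI => isInterval_of_mem_leaves (.inl hI)) (by norm_num) (by norm_num) h1 h5
  have ht : CarriesLeaves f t t' (5 / 6) (7 / 6) (5 / 6) (7 / 6) :=
    hf.forall₂_mapsLinearly (subdivides_leaves _ (by norm_num)) (subdivides_leaves _ (by norm_num))
      (fun I hI => isInterval_of_mem_leaves (.inr hI))
      (fun I hI => isInterval_of_mem_leaves (.inr hI)) (by norm_num) (by norm_num) h5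
      (by rw [coe_seven_sixths, h1])
  have ws : s.word = s'.word := hf.word_eq hR.hasUniquePartners (by norm_num) (by norm_num)
    (by norm_num) (fun _ h => .inl (.inr h)) (fun _ h => .inl (.inr h)) hs
  have wt : t.word = t'.word := hf.word_eq hR.hasUniquePartners (by norm_num) (by norm_num)
    (by norm_num) (fun _ h => .inr h) (fun _ h => .inr h) ht
  obtain ⟨g, hg, g1, g2⟩ := (assoc_of_word_eq ws).symm.exists_carriesLeaves
    (a := 1 / 6) (b := 5 / 6) (by norm_num) (by norm_num) isStandard_root
  obtain ⟨k, hk, k1, k2⟩ := (assoc_of_word_eq wt).symm.exists_carriesLeaves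
    (a := 5 / 6) (b := 7 / 6) (by norm_num) (by norm_num) isStandard_fourth
  -- On each side only one of `g` and `k` acts, the other being the identity there. The product maps
  -- every leaf of `s` and of `t` linearly to itself.
  have key : k * (g * f) = 1 := by
    ext z
    have hz : z ∈ ((↑) : ℝ → UnitAddCircle) '' Ico (1 / 6) (1 / 6 + 1) := by
      rw [AddCircle.coe_image_Ico_eq]; trivial
    obtain ⟨x, hx, rfl⟩ := hz
    change _ = (x : UnitAddCircle)
    rcases le_total x (5 / 6) with h | h
    · exact ((k1.carriesLeaves_left s (by norm_num) (by norm_num) le_rfl).mul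
        (g2.mul hs)).eq_self (by norm_num) ⟨hx.1, h⟩
    · exact (k2.mul ((g1.carriesLeaves_right t' le_rfl (by norm_num) (by norm_num)).mul
        ht)).eq_self (by norm_num) ⟨h, by linarith [hx.2]⟩
  have h : k * (g * f) ∈ generatedSubgroup := key ▸ one_mem _
  exact (Subgroup.mul_mem_cancel_left _ hg).1 ((Subgroup.mul_mem_cancel_left _ hk).1 h)

theorem generatedSubgroup_eq : generatedSubgroup = rearrangementGroup := by
  refine le_antisymm generatedSubgroup_le fun f hf => ?_
  obtain ⟨D, R, hD, hR, hc⟩ := mem_dyadicRearrangements_iff.1 hf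
  have hroot : s(((1 / 6 : ℝ) : UnitAddCircle), ((5 / 6 : ℝ) : UnitAddCircle)) ∈ D := by
    obtain ⟨l, m, r, t, rfl⟩ := hD.exists_tree
    exact .inl (.inl rfl)
  obtain ⟨g, hg, h1, h5⟩ := exists_move_to_root hR (hc.map_mem_iff.2 hroot)
  have h := mem_generated_of_fixes_root (mul_mem (generatedSubgroup_le hg) hf) h1 h5
  exact (Subgroup.mul_mem_cancel_left _ hg).1 h

end Basilica

/-- The dyadic rearrangements of the Basilica form a group under composition, this group is
generated by `α`, `β`, `γ`, `δ`, and hence it is finitely generated. -/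
theorem mainTheorem2 :
    ∃ T : Subgroup (UnitAddCircle ≃ₜ UnitAddCircle),
      (T : Set (UnitAddCircle ≃ₜ UnitAddCircle)) = Basilica.dyadicRearrangements ∧
      Subgroup.closure {Basilica.alpha, Basilica.beta, Basilica.gamma, Basilica.delta} = T ∧
      T.FG := by
  refine ⟨Basilica.rearrangementGroup, rfl, Basilica.generatedSubgroup_eq, ?_⟩
  rw [← Basilica.generatedSubgroup_eq, Basilica.generatedSubgroup]
  exact (Subgroup.fg_iff _).2 ⟨_, rfl, Set.toFinite _⟩
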